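/- Let $d\ge 1$ be an integer and $m>0$. Let $\mathbb S^d\subset\mathbb R^{d+1}$ be the unit sphere with its surface measure, $\mathbb S^d_p=\mathbb S^d\setminus\{(0,\dots,0,1)\}$, and let $\alpha:\mathbb S^d_p\to\mathbb R^d$, $\alpha_i(x)=x_i/(1-x_d)$ $(0\le i\le d-1)$, be the stereographic projection, with conformal factor $\Lambda_\alpha(x)=(1-x_d)^{-1}$; for $k=1,2,\dots$ let $\beta_k(y)=ky$ on $\mathbb R^d$, with conformal factor $\Lambda_{\beta_k}=k$. Let $U_\alpha:L^2(\mathbb R^d)\to L^2(\mathbb S^d_p)$ and $U_{\beta_k}:L^2(\mathbb R^d)\to L^2(\mathbb R^d)$ be the unitary operators $U_\eta f=\Lambda_\eta^{d/2}\,(f\circ\eta)$ on real $L^2$ spaces. For $f\in\mathcal D(\mathbb R^d)$ (real-valued test functions with the usual LF topology) $U_\alpha U_{\beta_k}f$, extended by zero, belongs to $\mathcal D(\mathbb S^d)=C^\infty(\mathbb S^d,\mathbb R)$ with its $C^\infty$ topology. The duals $\mathcal D'(\mathbb R^d)$ and $\mathcal D'(\mathbb S^d)$ carry the weak* topology, measures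 on them are Radon measures, and $S_\mu(f)=\int e^{i\phi(f)}\,d\mu(\phi)$ denotes the characteristic functional of $\mu$. Let $\Delta_E=-\sum_i\partial_i^2$ be the nonnegative selfadjoint Laplacian on $L^2(\mathbb R^d)$, let $J:L^2(\mathbb S^d_p)\to L^2(\mathbb S^d)$ be extension by zero, and put $$C_{S,k}=U_\alpha U_{\beta_k}(\Delta_E+m^2)^{-1}U_{\beta_k}^{-1}U_\alpha^{-1},\qquad \tilde C_{S,k}=J\,C_{S,k}\,J^*.$$ Let $\mu_{\tilde C_{S,k}}$ be the mean zero Gaussian probability measure on $\mathcal D'(\mathbb S^d)$ with covariance $\tilde C_{S,k}$, i.e. $S_{\mu_{\tilde C_{S,k}}}(f)=\exp\bigl(-\tfrac12\langle\tilde C_{S,k}f,f\rangle_{L^2(\mathbb S^d)}\bigr)$. Let $(\mu^S_k)_{k\ge1}$ be probability measures on $\mathcal D'(\mathbb S^d)$ and $K>0$ a constant such that $$\|\Psi\|_{L^1(\mu^S_k)}\le K\,\|\Psi\|_{L^2(\mu_{\tilde C_{S,k}})}$$ for every $k\ge 1$ and every bounded continuous $\Psi:\mathcal D'(\mathbb S^d)\to\mathbb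 C$. Then the functionals $S^k_{\mu^S}(f)=S_{\mu^S_k}(U_\alpha U_{\beta_k}f)$, $f\in\mathcal D(\mathbb R^d)$, $k\ge1$, form an equicontinuous sequence on $\mathcal D(\mathbb R^d)$. Moreover, there are a subsequence of $(S^k_{\mu^S})$ and a probability measure $\mu^E$ on $\mathcal D'(\mathbb R^d)$ such that $S_{\mu^E}$ is continuous on $\mathcal D(\mathbb R^d)$ and the subsequence converges to $S_{\mu^E}$ uniformly on compact subsets of $\mathcal D(\mathbb R^d)$. -/

import Mathlib

open MeasureTheory Module
open scoped ENNReal ContDiff Manifold EuclideanSpace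

noncomputable section
namespace ScalingLimit

/-- Euclidean space `ℝⁿ`. -/
abbrev Eu (n : ℕ) : Type := EuclideanSpace ℝ (Fin n)
/-- The unit sphere `𝕊^d` in `ℝ^(d+1)`. -/
abbrev Sph (d : ℕ) : Type := Metric.sphere (0 : Eu (d + 1)) 1

/-- The point `(0, …, 0, 1)`. -/
def northPole (d : ℕ) : Sph d :=
  ⟨EuclideanSpace.single (Fin.last d) 1, by simp⟩

/-- The punctured sphere `𝕊_p^d`. -/
abbrev PSph (d : ℕ) : Type := {x : Sph d // x ≠ northPole d}

/-- The Riemannian (surface) measure of the unit sphere. -/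
def sphMeas (d : ℕ) : Measure (Sph d) := (volume : Measure (Eu (d + 1))).toSphere

/-- The surface measure on the punctured sphere. -/
def psphMeas (d : ℕ) : Measure (PSph d) := (sphMeas d).comap Subtype.val

/-- The formula `x_i / (1 - x_d)` of the stereographic projection. -/
def stereoFun {d : ℕ} (x : Eu (d + 1)) : Eu d :=
  WithLp.toLp 2 fun i => x i.castSucc / (1 - x (Fin.last d))

/-- The formula of the inverse of the stereographic projection. -/
def stereoInvFun {d : ℕ} (y : Eu d) : Eu (d + 1) :=
  WithLp.toLp 2 (Fin.snoc (α := fun _ => ℝ) (fun i => 2 * y i / (‖y‖ ^ 2 + 1))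
    ((‖y‖ ^ 2 - 1) / (‖y‖ ^ 2 + 1)))

lemma sph_sum {d : ℕ} (x : Sph d) :
    ∑ i : Fin d, (x : Eu (d + 1)) i.castSucc ^ 2 + (x : Eu (d + 1)) (Fin.last d) ^ 2 = 1 := by
  have h : ‖(x : Eu (d + 1))‖ ^ 2 = 1 := by simp
  rwa [EuclideanSpace.real_norm_sq_eq, Fin.sum_univ_castSucc] at h

lemma last_lt_one {d : ℕ} {x : Sph d} (hx : x ≠ northPole d) :
    (x : Eu (d + 1)) (Fin.last d) < 1 := by
  have h := sph_sum x
  have h0 : 0 ≤ ∑ i : Fin d, (x : Eu (d + 1)) i.castSucc ^ 2 :=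
    Finset.sum_nonneg fun i _ => sq_nonneg _
  by_contra hc
  push Not at hc
  have h1 : (x : Eu (d + 1)) (Fin.last d) = 1 := by nlinarith
  apply hx
  have h2 : ∑ i : Fin d, (x : Eu (d + 1)) i.castSucc ^ 2 = 0 := by rw [h1] at h; linarith
  rw [Finset.sum_eq_zero_iff_of_nonneg (fun i _ => sq_nonneg _)] at h2
  ext i
  refine Fin.lastCases ?_ (fun j => ?_) i
  · simp [northPole, h1]
  · have := h2 j (Finset.mem_univ j)
    have h3 : (x : Eu (d + 1)) j.castSucc = 0 := by simpa using this
    simp [northPole, h3, (Fin.castSucc_lt_last j).ne]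

lemma norm_stereoFun_sq {d : ℕ} {x : Sph d} (hx : x ≠ northPole d) :
    ‖stereoFun (x : Eu (d + 1))‖ ^ 2 + 1 = 2 / (1 - (x : Eu (d + 1)) (Fin.last d)) := by
  have h := sph_sum x
  have h1 : 1 - (x : Eu (d + 1)) (Fin.last d) ≠ 0 := by linarith [last_lt_one hx]
  rw [EuclideanSpace.real_norm_sq_eq]
  simp only [stereoFun, div_pow, ← Finset.sum_div]
  rw [eq_sub_of_add_eq h]
  field_simp
  ring

lemma stereoInvFun_last {d : ℕ} (y : Eu d) :
    stereoInvFun y (Fin.last d) = (‖y‖ ^ 2 - 1) / (‖y‖ ^ 2 + 1) := by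
  simp [stereoInvFun]

lemma stereoInvFun_castSucc {d : ℕ} (y : Eu d) (i : Fin d) :
    stereoInvFun y i.castSucc = 2 * y i / (‖y‖ ^ 2 + 1) := by
  simp [stereoInvFun]

lemma norm_stereoInvFun {d : ℕ} (y : Eu d) : ‖stereoInvFun y‖ = 1 := by
  have h : ‖stereoInvFun y‖ ^ 2 = 1 := by
    rw [EuclideanSpace.real_norm_sq_eq, Fin.sum_univ_castSucc]
    simp only [stereoInvFun_last, stereoInvFun_castSucc, div_pow, mul_pow, ← Finset.sum_div,
      ← Finset.mul_sum, ← EuclideanSpace.real_norm_sq_eq]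
    have : ‖y‖ ^ 2 + 1 ≠ 0 := by positivity
    field_simp
    ring
  exact (pow_eq_one_iff_of_nonneg (norm_nonneg _) two_ne_zero).1 h

lemma one_sub_stereoInvFun_last {d : ℕ} (y : Eu d) :
    1 - stereoInvFun y (Fin.last d) = 2 / (‖y‖ ^ 2 + 1) := by
  rw [stereoInvFun_last]
  have : ‖y‖ ^ 2 + 1 ≠ 0 := by positivity
  field_simp
  ring

/-- The stereographic projection `α : 𝕊_p^d → ℝ^d`, `α_i(x) = x_i / (1 - x_d)`. -/
def stereo (d : ℕ) : PSph d ≃ₜ Eu d where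
  toFun x := stereoFun (x.1 : Eu (d + 1))
  invFun y := ⟨⟨stereoInvFun y, by simp [norm_stereoInvFun]⟩, by
    intro h
    have h1 := one_sub_stereoInvFun_last y
    have h2 : stereoInvFun y (Fin.last d) = 1 := by
      have := congrArg (fun z : Sph d => (z : Eu (d + 1)) (Fin.last d)) h
      simpa [northPole] using this
    have h3 : (0 : ℝ) < 2 / (‖y‖ ^ 2 + 1) := by positivity
    linarith⟩
  left_inv x := by
    have h := norm_stereoFun_sq x.2
    have h1 : 1 - (x.1 : Eu (d + 1)) (Fin.last d) ≠ 0 := by linarith [last_lt_one x.2]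
    ext i
    refine Fin.lastCases ?_ (fun j => ?_) i
    · change stereoInvFun (stereoFun (x.1 : Eu (d + 1))) (Fin.last d) = _
      have := one_sub_stereoInvFun_last (stereoFun (x.1 : Eu (d + 1)))
      rw [h] at this
      field_simp at this
      linarith
    · change stereoInvFun (stereoFun (x.1 : Eu (d + 1))) j.castSucc = _
      rw [stereoInvFun_castSucc, h]
      simp only [stereoFun]
      field_simp
  right_inv y := by
    ext i
    change stereoInvFun y i.castSucc / (1 - stereoInvFun y (Fin.last d)) = _
    rw [one_sub_stereoInvFun_last, stereoInvFun_castSucc]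
    field_simp
  continuous_toFun := by
    unfold stereoFun
    refine (PiLp.continuous_toLp 2 _).comp (continuous_pi fun i => ?_)
    refine Continuous.div (by fun_prop) (by fun_prop) fun x => ?_
    linarith [last_lt_one x.2]
  continuous_invFun := by
    refine Continuous.subtype_mk (Continuous.subtype_mk ?_ _) _
    unfold stereoInvFun
    refine (PiLp.continuous_toLp 2 _).comp (continuous_pi fun i => ?_)
    refine Fin.lastCases ?_ (fun j => ?_) i
    · simp only [Fin.snoc_last]
      exact Continuous.div (by fun_prop) (by fun_prop) fun y => by positivity
    · simp only [Fin.snoc_castSucc]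
      exact Continuous.div (by fun_prop) (by fun_prop) fun y => by positivity


/-- Orthogonal projection onto the equatorial hyperplane. -/
def eqProj (d : ℕ) : Eu (d + 1) →L[ℝ] Eu (d + 1) :=
  LinearMap.toContinuousLinearMap
    (Matrix.toEuclideanLin (Matrix.diagonal (Fin.snoc (α := fun _ => ℝ) (fun _ : Fin d => 1) 0)))

lemma eqProj_castSucc {d : ℕ} (z : Eu (d + 1)) (i : Fin d) :
    eqProj d z i.castSucc = z i.castSucc := by
  simp [eqProj, Matrix.toLpLin_apply, Matrix.mulVec_diagonal]

lemma eqProj_last {d : ℕ} (z : Eu (d + 1)) : eqProj d z (Fin.last d) = 0 := by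
  simp [eqProj, Matrix.toLpLin_apply, Matrix.mulVec_diagonal]

/-- The first `d` coordinates. -/
def eqCoord {d : ℕ} (z : Eu (d + 1)) : Eu d := WithLp.toLp 2 fun i => z i.castSucc

lemma norm_eqProj {d : ℕ} (z : Eu (d + 1)) : ‖eqProj d z‖ ^ 2 = ‖eqCoord z‖ ^ 2 := by
  rw [EuclideanSpace.real_norm_sq_eq, EuclideanSpace.real_norm_sq_eq, Fin.sum_univ_castSucc]
  simp [eqProj_castSucc, eqProj_last, eqCoord]

/-- The north pole as a vector of the ambient space. -/
abbrev nP (d : ℕ) : Eu (d + 1) := EuclideanSpace.single (Fin.last d) 1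

lemma norm_eqProj_sub {d : ℕ} (z : Eu (d + 1)) :
    ‖eqProj d z - nP d‖ ^ 2 = ‖eqCoord z‖ ^ 2 + 1 := by
  rw [EuclideanSpace.real_norm_sq_eq, EuclideanSpace.real_norm_sq_eq, Fin.sum_univ_castSucc]
  simp [eqProj_castSucc, eqProj_last, eqCoord, (Fin.castSucc_lt_last _).ne]

lemma stereoInvFun_eq {d : ℕ} (z : Eu (d + 1)) :
    stereoInvFun (eqCoord z) = EuclideanGeometry.inversion (nP d) (√2) (eqProj d z) := by
  have h0 : ‖eqCoord z‖ ^ 2 + 1 ≠ 0 := by positivity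
  ext i
  simp only [EuclideanGeometry.inversion, dist_eq_norm, div_pow, norm_eqProj_sub,
    Real.sq_sqrt (zero_le_two), vsub_eq_sub, vadd_eq_add]
  refine Fin.lastCases ?_ (fun j => ?_) i
  · rw [stereoInvFun_last]
    simp [eqProj_last]
    field_simp
    ring
  · rw [stereoInvFun_castSucc]
    simp [eqProj_castSucc, (Fin.castSucc_lt_last _).ne, eqCoord]
    ring

/-- The reflection whose composition with dilations is the derivative of the inversion. -/
abbrev eqRefl {d : ℕ} (z : Eu (d + 1)) : Eu (d + 1) ≃ₗᵢ[ℝ] Eu (d + 1) :=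
  (ℝ ∙ (eqProj d z - nP d))ᗮ.reflection

lemma eqRefl_nP {d : ℕ} (z : Eu (d + 1)) : eqRefl z (nP d) = stereoInvFun (eqCoord z) := by
  have h0 : ‖eqCoord z‖ ^ 2 + 1 ≠ 0 := by positivity
  rw [stereoInvFun_eq, eqRefl, Submodule.reflection_orthogonal_apply,
    Submodule.reflection_singleton_apply]
  have h1 : inner ℝ (eqProj d z - nP d) (nP d) = -1 := by
    rw [EuclideanSpace.inner_single_right]
    simp [eqProj_last]
  have h2 : inner ℝ (eqProj d z) (nP d) = 0 := by
    rw [EuclideanSpace.inner_single_right]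
    simp [eqProj_last]
  simp only [EuclideanGeometry.inversion, dist_eq_norm, div_pow, norm_eqProj_sub,
    Real.sq_sqrt (zero_le_two), vsub_eq_sub, vadd_eq_add, h1]
  rw [RCLike.ofReal_real_eq_id]
  simp only [id, norm_eqProj_sub]
  module

/-- The map `(y, r) ↦ r α⁻¹(y)`, used to compute the surface measure in stereographic
coordinates. -/
def coneMap {d : ℕ} (z : Eu (d + 1)) : Eu (d + 1) :=
  z (Fin.last d) • stereoInvFun (eqCoord z)

/-- The derivative of `coneMap` up to a reflection. -/
def coneDiag {d : ℕ} (z : Eu (d + 1)) : Eu (d + 1) →L[ℝ] Eu (d + 1) :=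
  LinearMap.toContinuousLinearMap (Matrix.toEuclideanLin (Matrix.diagonal
    (Fin.snoc (α := fun _ => ℝ)
      (fun _ : Fin d => z (Fin.last d) * (2 / (‖eqCoord z‖ ^ 2 + 1))) 1)))

lemma coneDiag_eq {d : ℕ} (z v : Eu (d + 1)) :
    coneDiag z v = (z (Fin.last d) * (2 / (‖eqCoord z‖ ^ 2 + 1))) • eqProj d v
      + v (Fin.last d) • nP d := by
  ext i
  refine Fin.lastCases ?_ (fun j => ?_) i
  · simp [coneDiag, Matrix.toLpLin_apply, Matrix.mulVec_diagonal, eqProj_last]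
  · simp [coneDiag, Matrix.toLpLin_apply, Matrix.mulVec_diagonal, eqProj_castSucc,
      (Fin.castSucc_lt_last _).ne]

lemma coneDiag_det {d : ℕ} (z : Eu (d + 1)) :
    (coneDiag z).det = (z (Fin.last d) * (2 / (‖eqCoord z‖ ^ 2 + 1))) ^ d := by
  rw [coneDiag, ContinuousLinearMap.det, LinearMap.coe_toContinuousLinearMap,
    Matrix.toEuclideanLin_eq_toLin_orthonormal, LinearMap.det_toLin, Matrix.det_diagonal,
    Fin.prod_univ_castSucc]
  simp

/-- The derivative of `coneMap`. -/
def coneDeriv {d : ℕ} (z : Eu (d + 1)) : Eu (d + 1) →L[ℝ] Eu (d + 1) :=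
  (eqRefl z : Eu (d + 1) →L[ℝ] Eu (d + 1)).comp (coneDiag z)

lemma coneDeriv_det {d : ℕ} (z : Eu (d + 1)) :
    |(coneDeriv z).det| = |(z (Fin.last d) * (2 / (‖eqCoord z‖ ^ 2 + 1))) ^ d| := by
  rw [← coneDiag_det, coneDeriv]
  have : ((eqRefl z : Eu (d + 1) →L[ℝ] Eu (d + 1)).comp (coneDiag z)).det
      = LinearMap.det ((eqRefl z).toLinearEquiv : Eu (d + 1) →ₗ[ℝ] Eu (d + 1))
        * (coneDiag z).det := by
    rw [ContinuousLinearMap.det, ContinuousLinearMap.det, ← LinearMap.det_comp]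
    rfl
  rw [this, abs_mul]
  have h : |LinearMap.det ((eqRefl z).toLinearEquiv : Eu (d + 1) →ₗ[ℝ] Eu (d + 1))| = 1 := by
    have := (ℝ ∙ (eqProj d z - nP d))ᗮ.det_reflection
    have h2 : LinearMap.det ((eqRefl z).toLinearEquiv : Eu (d + 1) →ₗ[ℝ] Eu (d + 1)) =
      LinearMap.det ((ℝ ∙ (eqProj d z - nP d))ᗮ.reflection.toLinearMap) := rfl
    rw [h2, this]
    simp
  rw [h, one_mul]

lemma hasFDerivAt_coneMap {d : ℕ} (z : Eu (d + 1)) : HasFDerivAt coneMap (coneDeriv z) z := by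
  have hne : eqProj d z ≠ nP d := by
    intro h
    have := norm_eqProj_sub z
    rw [h] at this
    simp at this
    nlinarith [norm_nonneg (eqCoord z)]
  have h1 : HasFDerivAt (fun z : Eu (d + 1) => z (Fin.last d))
      (EuclideanSpace.proj (Fin.last d) : Eu (d + 1) →L[ℝ] ℝ) z :=
    (EuclideanSpace.proj (Fin.last d) : Eu (d + 1) →L[ℝ] ℝ).hasFDerivAt
  have h2 := (EuclideanGeometry.hasFDerivAt_inversion (R := √2) hne).comp z
    (eqProj d).hasFDerivAt
  have h3 := h1.smul h2
  have hfun : coneMap (d := d) = fun z : Eu (d + 1) => z (Fin.last d) •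
      (EuclideanGeometry.inversion (nP d) (√2) ∘ (eqProj d)) z := by
    funext z
    simp [coneMap, stereoInvFun_eq]
  rw [hfun]
  refine h3.congr_fderiv ?_
  ext1 v
  have h4 : eqRefl z (nP d) = _ := eqRefl_nP z
  simp only [coneDeriv, ContinuousLinearMap.comp_apply, coneDiag_eq]
  change _ = eqRefl z _
  rw [map_add, map_smul, map_smul, h4, stereoInvFun_eq]
  simp [dist_eq_norm, div_pow, norm_eqProj_sub, smul_smul]


lemma measurePreserving_split (d : ℕ) :
    MeasurePreserving (fun z : Eu (d + 1) => (z (Fin.last d), eqCoord z)) volume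
      ((volume : Measure ℝ).prod (volume : Measure (Eu d))) := by
  have h1 : MeasurePreserving (@WithLp.ofLp 2 (Fin (d + 1) → ℝ)) volume volume :=
    PiLp.volume_preserving_ofLp (Fin (d + 1))
  have h2 := volume_preserving_piFinSuccAbove (fun _ : Fin (d + 1) => ℝ) (Fin.last d)
  have h3 : MeasurePreserving (@WithLp.toLp 2 (Fin d → ℝ)) volume volume :=
    PiLp.volume_preserving_toLp (Fin d)
  have h4 := (((MeasurePreserving.id (volume : Measure ℝ)).prod h3).comp h2).comp h1
  convert h4 using 1
  funext z
  simp only [Function.comp_apply, Prod.map, id]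
  refine Prod.ext ?_ ?_
  · simp [MeasurableEquiv.piFinSuccAbove]
  · simp only [MeasurableEquiv.piFinSuccAbove, eqCoord]
    ext i
    simp [Fin.insertNthEquiv, Fin.init]

lemma coneMap_injOn {d : ℕ} (A : Set (Eu d)) :
    Set.InjOn (coneMap (d := d)) {z | z (Fin.last d) ∈ Set.Ioo (0 : ℝ) 1 ∧ eqCoord z ∈ A} := by
  rintro z ⟨⟨hz, -⟩, -⟩ w ⟨⟨hw, -⟩, -⟩ h
  have hr : z (Fin.last d) = w (Fin.last d) := by
    have := congrArg norm h
    simpa [coneMap, norm_smul, norm_stereoInvFun, abs_of_pos hz, abs_of_pos hw] using this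
  have hy : stereoInvFun (eqCoord z) = stereoInvFun (eqCoord w) := by
    simp only [coneMap, hr] at h
    exact smul_right_injective _ hw.ne' h
  have hy' : eqCoord z = eqCoord w := by
    apply (stereo d).symm.injective
    apply Subtype.ext
    apply Subtype.ext
    exact hy
  ext i
  refine Fin.lastCases hr (fun j => ?_) i
  exact congrArg (fun y : Eu d => y j) hy'

open scoped Pointwise in
lemma coneMap_image {d : ℕ} (A : Set (Eu d)) :
    Set.Ioo (0 : ℝ) 1 • ((↑) '' (Subtype.val '' (stereo d ⁻¹' A)) : Set (Eu (d + 1))) =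
      coneMap '' {z | z (Fin.last d) ∈ Set.Ioo (0 : ℝ) 1 ∧ eqCoord z ∈ A} := by
  ext w
  simp only [Set.mem_smul, Set.mem_image, Set.mem_preimage, Set.mem_setOf_eq]
  constructor
  · rintro ⟨r, hr, _, ⟨_, ⟨x, hx, rfl⟩, rfl⟩, rfl⟩
    refine ⟨WithLp.toLp 2 (Fin.snoc (α := fun _ => ℝ) (stereo d x) r), ?_, ?_⟩
    · refine ⟨by simpa using hr, ?_⟩
      have : eqCoord (WithLp.toLp 2 (Fin.snoc (α := fun _ => ℝ) (stereo d x) r)) = stereo d x := by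
        ext i
        simp [eqCoord]
      rwa [this]
    · have : stereoInvFun (stereo d x) = ((x : Sph d) : Eu (d + 1)) :=
        congrArg (fun z : PSph d => ((z : Sph d) : Eu (d + 1))) ((stereo d).symm_apply_apply x)
      simp [coneMap, eqCoord, this]
  · rintro ⟨z, ⟨hz, hA⟩, rfl⟩
    refine ⟨_, hz, _, ⟨_, ⟨(stereo d).symm (eqCoord z), by simpa using hA, rfl⟩, rfl⟩, rfl⟩

lemma measurableSet_pSph (d : ℕ) : MeasurableSet {x : Sph d | x ≠ northPole d} :=
  (measurableSet_singleton _).compl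

lemma psphMeas_preimage {d : ℕ} {A : Set (Eu d)} (hA : MeasurableSet A) :
    psphMeas d (stereo d ⁻¹' A) = ∫⁻ y in A, ENNReal.ofReal ((2 / (‖y‖ ^ 2 + 1)) ^ d) := by
  have hpre : MeasurableSet (stereo d ⁻¹' A) := (stereo d).measurable hA
  have hemb : MeasurableEmbedding (Subtype.val : PSph d → Sph d) :=
    MeasurableEmbedding.subtype_coe (measurableSet_pSph d)
  rw [psphMeas, hemb.comap_apply, sphMeas,
    Measure.toSphere_apply' _ (hemb.measurableSet_image.2 hpre), coneMap_image]
  have hs : {z : Eu (d + 1) | z (Fin.last d) ∈ Set.Ioo (0 : ℝ) 1 ∧ eqCoord z ∈ A} =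
      (fun z : Eu (d + 1) => (z (Fin.last d), eqCoord z)) ⁻¹' (Set.Ioo (0 : ℝ) 1 ×ˢ A) := rfl
  have hms : MeasurableSet
      {z : Eu (d + 1) | z (Fin.last d) ∈ Set.Ioo (0 : ℝ) 1 ∧ eqCoord z ∈ A} := by
    rw [hs]
    exact (measurePreserving_split d).measurable (measurableSet_Ioo.prod hA)
  rw [← lintegral_abs_det_fderiv_eq_addHaar_image volume hms
    (fun z _ => (hasFDerivAt_coneMap z).hasFDerivWithinAt) (coneMap_injOn A)]
  simp_rw [coneDeriv_det]
  have hmeas : Measurable fun p : ℝ × Eu d =>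
      ENNReal.ofReal |(p.1 * (2 / (‖p.2‖ ^ 2 + 1))) ^ d| := by fun_prop
  rw [hs]
  have := (measurePreserving_split d).setLIntegral_comp_preimage
    (s := Set.Ioo (0 : ℝ) 1 ×ˢ A) (measurableSet_Ioo.prod hA) hmeas
  simp only at this
  rw [this, ← Measure.prod_restrict]
  have hsplit : ∀ p : ℝ × Eu d, ENNReal.ofReal |(p.1 * (2 / (‖p.2‖ ^ 2 + 1))) ^ d| =
      ENNReal.ofReal (|p.1| ^ d) * ENNReal.ofReal ((2 / (‖p.2‖ ^ 2 + 1)) ^ d) := by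
    intro p
    rw [← ENNReal.ofReal_mul (by positivity), mul_pow, abs_mul, abs_pow,
      abs_of_nonneg (a := (2 / (‖p.2‖ ^ 2 + 1)) ^ d) (by positivity)]
  simp_rw [hsplit]
  rw [lintegral_prod_mul (f := fun r : ℝ => ENNReal.ofReal (|r| ^ d))
    (g := fun y : Eu d => ENNReal.ofReal ((2 / (‖y‖ ^ 2 + 1)) ^ d))
    (by fun_prop) (by fun_prop), ← mul_assoc]
  have hrad : ∫⁻ r in Set.Ioo (0 : ℝ) 1, ENNReal.ofReal (|r| ^ d)
      = ENNReal.ofReal (1 / ((d : ℝ) + 1)) := by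
    rw [setLIntegral_congr_fun (g := fun r : ℝ => ENNReal.ofReal (r ^ d)) measurableSet_Ioo
      (fun r hr => by rw [abs_of_pos hr.1])]
    rw [← ofReal_integral_eq_lintegral_ofReal, ← integral_Ioc_eq_integral_Ioo,
      ← intervalIntegral.integral_of_le zero_le_one, integral_pow]
    · simp
    · exact ((continuous_pow d).integrableOn_Icc).mono_set Set.Ioo_subset_Icc_self
    · filter_upwards [ae_restrict_mem measurableSet_Ioo] with r hr
      exact pow_nonneg hr.1.le _
  rw [hrad]
  have hone : ((finrank ℝ (Eu (d + 1)) : ℕ) : ℝ≥0∞) * ENNReal.ofReal (1 / ((d : ℝ) + 1)) = 1 := by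
    rw [finrank_euclideanSpace_fin, ← ENNReal.ofReal_natCast,
      ← ENNReal.ofReal_mul (by positivity)]
    have : (((d + 1 : ℕ) : ℝ)) * (1 / ((d : ℝ) + 1)) = 1 := by
      push_cast
      field_simp
    rw [this, ENNReal.ofReal_one]
  rw [hone, one_mul]

/-- The conformal factor `Λ_α(x) = (1 - x_d)⁻¹` of the stereographic projection. -/
def stereoFactor {d : ℕ} (x : PSph d) : ℝ := (1 - (x.1 : Eu (d + 1)) (Fin.last d))⁻¹

lemma stereoFactor_pos {d : ℕ} (x : PSph d) : 0 < stereoFactor x :=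
  inv_pos.2 (by linarith [last_lt_one x.2])

lemma continuous_stereoFactor {d : ℕ} : Continuous (stereoFactor (d := d)) := by
  unfold stereoFactor
  exact Continuous.inv₀ (by fun_prop) fun x => by linarith [last_lt_one x.2]

/-- `α` pulls Lebesgue measure back to `Λ_α^d` times the surface measure. -/
lemma stereo_map (d : ℕ) :
    ((psphMeas d).withDensity fun x => ENNReal.ofReal (stereoFactor x ^ d)).map (stereo d)
      = volume := by
  have hfac : ∀ x : PSph d, stereoFactor x = (‖stereo d x‖ ^ 2 + 1) / 2 := by
    intro x
    have h : ‖stereo d x‖ ^ 2 + 1 = _ := norm_stereoFun_sq x.2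
    rw [h, stereoFactor]
    have : 1 - (x.1 : Eu (d + 1)) (Fin.last d) ≠ 0 := by linarith [last_lt_one x.2]
    field_simp
  have hmap : (psphMeas d).map (stereo d) =
      volume.withDensity fun y : Eu d => ENNReal.ofReal ((2 / (‖y‖ ^ 2 + 1)) ^ d) := by
    ext A hA
    rw [Measure.map_apply (stereo d).measurable hA, psphMeas_preimage hA,
      withDensity_apply _ hA]
  ext A hA
  rw [Measure.map_apply (stereo d).measurable hA, withDensity_apply _ ((stereo d).measurable hA)]
  simp_rw [hfac]
  rw [← setLIntegral_map (f := fun y : Eu d => ENNReal.ofReal (((‖y‖ ^ 2 + 1) / 2) ^ d)) hA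
    (by fun_prop) (stereo d).measurable, hmap,
    setLIntegral_withDensity_eq_setLIntegral_mul _ (by fun_prop) (by fun_prop) hA]
  have : ∀ y : Eu d, ((fun y : Eu d => ENNReal.ofReal ((2 / (‖y‖ ^ 2 + 1)) ^ d)) *
      fun y : Eu d => ENNReal.ofReal (((‖y‖ ^ 2 + 1) / 2) ^ d)) y = 1 := by
    intro y
    rw [Pi.mul_apply, ← ENNReal.ofReal_mul (by positivity), ← mul_pow]
    have : 2 / (‖y‖ ^ 2 + 1) * ((‖y‖ ^ 2 + 1) / 2) = 1 := by field_simp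
    rw [this, one_pow, ENNReal.ofReal_one]
  simp_rw [this]
  simp

lemma scale_map (d : ℕ) {k : ℝ} (hk : 0 < k) :
    ((volume : Measure (Eu d)).withDensity fun _ => ENNReal.ofReal (k ^ d)).map
      (Homeomorph.smulOfNeZero k hk.ne') = volume := by
  have h := Measure.map_addHaar_smul (volume : Measure (Eu d)) hk.ne'
  have hcoe : (⇑(Homeomorph.smulOfNeZero k hk.ne' : Eu d ≃ₜ Eu d)) = (k • ·) := rfl
  rw [withDensity_const, Measure.map_smul, hcoe, h, finrank_euclideanSpace_fin, smul_smul,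
    ← ENNReal.ofReal_mul (by positivity), abs_of_pos (by positivity),
    mul_inv_cancel₀ (by positivity), ENNReal.ofReal_one, one_smul]


section ConformalUnitary

variable {X Y : Type*} [TopologicalSpace X] [MeasurableSpace X] [BorelSpace X]
  [TopologicalSpace Y] [MeasurableSpace Y] [BorelSpace Y]

/-- `η` pulls the volume `ν` back to `Λ^d μ`, as a conformal diffeomorphism of `d`-dimensional
Riemannian manifolds with conformal factor `Λ` does. Proved below for the two maps in use. -/
structure IsConformalVol (d : ℕ) (μ : Measure X) (ν : Measure Y) (η : X ≃ₜ Y) (Λ : X → ℝ) :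
    Prop where
  continuous : Continuous Λ
  pos : ∀ x, 0 < Λ x
  map_eq : (μ.withDensity fun x => ENNReal.ofReal (Λ x ^ d)).map η = ν

variable {d : ℕ} {μ : Measure X} {ν : Measure Y} {η : X ≃ₜ Y} {Λ : X → ℝ}

lemma IsConformalVol.eLpNorm_eq (h : IsConformalVol d μ ν η Λ) (f : Y → ℝ) :
    eLpNorm (fun x => Λ x ^ ((d : ℝ) / 2) * f (η x)) 2 μ = eLpNorm f 2 ν := by
  have hL : Measurable fun x => ENNReal.ofReal (Λ x ^ d) :=
    (h.continuous.measurable.pow_const d).ennreal_ofReal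
  rw [eLpNorm_eq_lintegral_rpow_enorm_toReal two_ne_zero ENNReal.ofNat_ne_top,
    eLpNorm_eq_lintegral_rpow_enorm_toReal two_ne_zero ENNReal.ofNat_ne_top, ← h.map_eq,
    η.measurableEmbedding.lintegral_map,
    lintegral_withDensity_eq_lintegral_mul_non_measurable _ hL
      (Filter.Eventually.of_forall fun x => ENNReal.ofReal_lt_top)]
  congr 1
  refine lintegral_congr fun x => ?_
  have hp := h.pos x
  rw [Pi.mul_apply, enorm_mul, ENNReal.mul_rpow_of_nonneg _ _ (by positivity)]
  congr 1
  rw [Real.enorm_eq_ofReal (by positivity), ENNReal.ofReal_rpow_of_nonneg (by positivity)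
    (by positivity), ← Real.rpow_mul hp.le]
  simp

lemma IsConformalVol.memLp (h : IsConformalVol d μ ν η Λ) {f : Y → ℝ} (hf : MemLp f 2 ν) :
    MemLp (fun x => Λ x ^ ((d : ℝ) / 2) * f (η x)) 2 μ := by
  refine ⟨?_, by rw [h.eLpNorm_eq]; exact hf.2⟩
  have hL : Measurable fun x => ENNReal.ofReal (Λ x ^ d) :=
    (h.continuous.measurable.pow_const d).ennreal_ofReal
  have hac : μ ≪ μ.withDensity fun x => ENNReal.ofReal (Λ x ^ d) :=
    withDensity_absolutelyContinuous' hL.aemeasurable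
      (Filter.Eventually.of_forall fun x => by simp [pow_pos (h.pos x) d])
  have h1 : AEStronglyMeasurable f
      ((μ.withDensity fun x => ENNReal.ofReal (Λ x ^ d)).map η) := by
    rw [h.map_eq]; exact hf.1
  have h2 : AEStronglyMeasurable (fun x => f (η x)) μ :=
    (h1.comp_measurable η.measurable).mono_ac hac
  exact ((h.continuous.measurable.pow_const _).aestronglyMeasurable).mul h2

lemma IsConformalVol.ae_comp (h : IsConformalVol d μ ν η Λ) {p : Y → Prop}
    (hp : ∀ᵐ y ∂ν, p y) : ∀ᵐ x ∂μ, p (η x) := by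
  have hL : Measurable fun x => ENNReal.ofReal (Λ x ^ d) :=
    (h.continuous.measurable.pow_const d).ennreal_ofReal
  have hac : μ ≪ μ.withDensity fun x => ENNReal.ofReal (Λ x ^ d) :=
    withDensity_absolutelyContinuous' hL.aemeasurable
      (Filter.Eventually.of_forall fun x => by simp [pow_pos (h.pos x) d])
  rw [← h.map_eq, η.measurableEmbedding.ae_map_iff] at hp
  exact hac.ae_le hp

/-- The isometry `U_η f = Λ^(d/2) (f ∘ η)` from `L²(ν)` to `L²(μ)`. -/
def conformalIsometry (h : IsConformalVol d μ ν η Λ) : Lp ℝ 2 ν →ₗᵢ[ℝ] Lp ℝ 2 μ where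
  toFun f := (h.memLp (Lp.memLp f)).toLp _
  map_add' f g := by
    ext1
    filter_upwards [(h.memLp (Lp.memLp (f + g))).coeFn_toLp, (h.memLp (Lp.memLp f)).coeFn_toLp,
      (h.memLp (Lp.memLp g)).coeFn_toLp, h.ae_comp (Lp.coeFn_add f g),
      Lp.coeFn_add ((h.memLp (Lp.memLp f)).toLp _) ((h.memLp (Lp.memLp g)).toLp _)]
      with x h1 h2 h3 h4 h5
    rw [h1, h5, Pi.add_apply, h2, h3, h4, Pi.add_apply, mul_add]
  map_smul' c f := by
    ext1
    filter_upwards [(h.memLp (Lp.memLp (c • f))).coeFn_toLp, (h.memLp (Lp.memLp f)).coeFn_toLp,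
      h.ae_comp (Lp.coeFn_smul c f), Lp.coeFn_smul c ((h.memLp (Lp.memLp f)).toLp _)]
      with x h1 h2 h3 h4
    rw [RingHom.id_apply, h1, h4, Pi.smul_apply, h2, h3, Pi.smul_apply, smul_eq_mul, smul_eq_mul]
    ring
  norm_map' f := by
    change ‖(h.memLp (Lp.memLp f)).toLp _‖ = _
    rw [Lp.norm_toLp, h.eLpNorm_eq, Lp.norm_def]

lemma conformalIsometry_coeFn (h : IsConformalVol d μ ν η Λ) (f : Lp ℝ 2 ν) :
    conformalIsometry h f =ᵐ[μ] fun x => Λ x ^ ((d : ℝ) / 2) * f (η x) :=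
  (h.memLp (Lp.memLp f)).coeFn_toLp

lemma conformalIsometry_surjective (h : IsConformalVol d μ ν η Λ) :
    Function.Surjective (conformalIsometry h) := by
  intro g
  set f : Y → ℝ := fun y => (Λ (η.symm y) ^ ((d : ℝ) / 2))⁻¹ * g (η.symm y) with hf
  have hcomp : ∀ x, Λ x ^ ((d : ℝ) / 2) * f (η x) = g x := fun x => by
    have := (Real.rpow_pos_of_pos (h.pos x) ((d : ℝ) / 2)).ne'
    simp [hf, this]
  have hmeas : AEStronglyMeasurable f ν := by
    refine AEStronglyMeasurable.mul ?_ ?_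
    · exact (((h.continuous.comp η.symm.continuous).measurable.pow_const _).inv).aestronglyMeasurable
    · rw [← h.map_eq, η.measurableEmbedding.aestronglyMeasurable_map_iff]
      have : (fun y => g (η.symm y)) ∘ η = g := by funext x; simp
      rw [this]
      exact (Lp.aestronglyMeasurable g).mono_ac (withDensity_absolutelyContinuous _ _)
  have hmem : MemLp f 2 ν := by
    refine ⟨hmeas, ?_⟩
    rw [← h.eLpNorm_eq]
    simp_rw [hcomp]
    exact (Lp.memLp g).2
  refine ⟨hmem.toLp f, ?_⟩
  ext1
  filter_upwards [conformalIsometry_coeFn h (hmem.toLp f), h.ae_comp hmem.coeFn_toLp] with x h1 h2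
  rw [h1, h2, hcomp]

/-- The unitary operator `U_η f = Λ^(d/2) (f ∘ η)` from `L²(ν)` to `L²(μ)`. -/
def conformalUnitary (h : IsConformalVol d μ ν η Λ) : Lp ℝ 2 ν ≃ₗᵢ[ℝ] Lp ℝ 2 μ :=
  LinearIsometryEquiv.ofSurjective (conformalIsometry h) (conformalIsometry_surjective h)

end ConformalUnitary

lemma isConformalVol_stereo (d : ℕ) :
    IsConformalVol d (psphMeas d) (volume : Measure (Eu d)) (stereo d) stereoFactor where
  continuous := continuous_stereoFactor
  pos := stereoFactor_pos
  map_eq := stereo_map d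

lemma isConformalVol_scale (d : ℕ) {k : ℝ} (hk : 0 < k) :
    IsConformalVol d (volume : Measure (Eu d)) (volume : Measure (Eu d))
      (Homeomorph.smulOfNeZero k hk.ne') (fun _ => k) where
  continuous := continuous_const
  pos _ := hk
  map_eq := scale_map d hk

/-- `U_α : L²(ℝ^d) → L²(𝕊_p^d)` for the stereographic projection `α`. -/
def UAlpha (d : ℕ) : Lp ℝ 2 (volume : Measure (Eu d)) ≃ₗᵢ[ℝ] Lp ℝ 2 (psphMeas d) :=
  conformalUnitary (isConformalVol_stereo d)

/-- `U_{β_k} : L²(ℝ^d) → L²(ℝ^d)` for the scaling map `β_k y = k y`, of conformal factor `k`. -/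
def UBeta (d : ℕ) (k : ℕ+) :
    Lp ℝ 2 (volume : Measure (Eu d)) ≃ₗᵢ[ℝ] Lp ℝ 2 (volume : Measure (Eu d)) :=
  conformalUnitary (isConformalVol_scale d (k := (k : ℝ)) (by exact_mod_cast k.pos))

lemma pSph_emb (d : ℕ) : MeasurableEmbedding (Subtype.val : PSph d → Sph d) :=
  MeasurableEmbedding.subtype_coe (measurableSet_pSph d)

lemma map_psphMeas (d : ℕ) :
    (psphMeas d).map Subtype.val = (sphMeas d).restrict {x | x ≠ northPole d} := by
  rw [psphMeas, (pSph_emb d).map_comap, Subtype.range_coe_subtype]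

/-- Extension by zero from the punctured sphere to the sphere. -/
def extendZero {d : ℕ} (f : PSph d → ℝ) : Sph d → ℝ := Function.extend Subtype.val f 0

lemma extendZero_val {d : ℕ} (f : PSph d → ℝ) (x : PSph d) : extendZero f x.1 = f x :=
  Subtype.val_injective.extend_apply f 0 x

lemma extendZero_indicator {d : ℕ} (f : PSph d → ℝ) :
    {x | x ≠ northPole d}.indicator (extendZero f) = extendZero f := by
  funext x
  by_cases hx : x ≠ northPole d
  · exact Set.indicator_of_mem (s := {x | x ≠ northPole d}) hx _
  · rw [Set.indicator_of_notMem (s := {x | x ≠ northPole d}) hx]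
    refine (Function.extend_apply' (f := Subtype.val) f 0 x ?_).symm
    rintro ⟨y, rfl⟩
    exact hx y.2

lemma eLpNorm_extendZero {d : ℕ} (f : PSph d → ℝ) :
    eLpNorm (extendZero f) 2 (sphMeas d) = eLpNorm f 2 (psphMeas d) := by
  rw [← extendZero_indicator, eLpNorm_indicator_eq_eLpNorm_restrict (measurableSet_pSph d),
    ← map_psphMeas, (pSph_emb d).eLpNorm_map_measure]
  congr 1
  funext x
  exact extendZero_val f x

lemma memLp_extendZero {d : ℕ} {f : PSph d → ℝ} (hf : MemLp f 2 (psphMeas d)) :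
    MemLp (extendZero f) 2 (sphMeas d) := by
  refine ⟨?_, by rw [eLpNorm_extendZero]; exact hf.2⟩
  rw [← extendZero_indicator, aestronglyMeasurable_indicator_iff (measurableSet_pSph d),
    ← map_psphMeas, (pSph_emb d).aestronglyMeasurable_map_iff]
  have : extendZero f ∘ Subtype.val = f := funext fun x => extendZero_val f x
  rw [this]
  exact hf.1

lemma extendZero_ae {d : ℕ} {f g : PSph d → ℝ} (h : f =ᵐ[psphMeas d] g) :
    extendZero f =ᵐ[sphMeas d] extendZero g := by
  have h1 : ∀ᵐ x ∂((sphMeas d).restrict {x | x ≠ northPole d}), extendZero f x = extendZero g x := by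
    rw [← map_psphMeas, (pSph_emb d).ae_map_iff]
    filter_upwards [h] with x hx
    rw [extendZero_val, extendZero_val, hx]
  rw [ae_restrict_iff' (measurableSet_pSph d)] at h1
  filter_upwards [h1] with x hx
  rw [← extendZero_indicator f, ← extendZero_indicator g]
  by_cases h2 : x ∈ {x | x ≠ northPole d}
  · rw [Set.indicator_of_mem h2, Set.indicator_of_mem h2, hx h2]
  · rw [Set.indicator_of_notMem h2, Set.indicator_of_notMem h2]

lemma extendZero_add {d : ℕ} (f g : PSph d → ℝ) :
    extendZero (f + g) = extendZero f + extendZero g := by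
  funext x
  by_cases hx : ∃ y : PSph d, y.1 = x
  · obtain ⟨y, rfl⟩ := hx
    simp only [Pi.add_apply, extendZero_val]
  · simp [extendZero, Function.extend_apply' _ _ _ hx]

lemma extendZero_smul {d : ℕ} (c : ℝ) (f : PSph d → ℝ) :
    extendZero (c • f) = c • extendZero f := by
  funext x
  by_cases hx : ∃ y : PSph d, y.1 = x
  · obtain ⟨y, rfl⟩ := hx
    simp only [Pi.smul_apply, extendZero_val]
  · simp [extendZero, Function.extend_apply' _ _ _ hx]

/-- The isometric embedding `J : L²(𝕊_p^d) → L²(𝕊^d)`. -/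
def extendL2 (d : ℕ) : Lp ℝ 2 (psphMeas d) →ₗᵢ[ℝ] Lp ℝ 2 (sphMeas d) where
  toFun f := (memLp_extendZero (Lp.memLp f)).toLp _
  map_add' f g := by
    rw [← MemLp.toLp_add, MemLp.toLp_eq_toLp_iff, ← extendZero_add]
    exact extendZero_ae (Lp.coeFn_add f g)
  map_smul' c f := by
    rw [RingHom.id_apply, ← MemLp.toLp_const_smul, MemLp.toLp_eq_toLp_iff, ← extendZero_smul]
    exact extendZero_ae (Lp.coeFn_smul c f)
  norm_map' f := by
    change ‖(memLp_extendZero (Lp.memLp f)).toLp _‖ = _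
    rw [Lp.norm_toLp, eLpNorm_extendZero, Lp.norm_def]


lemma resolventSymbol_memLp (d : ℕ) {m : ℝ} (hm : 0 < m) :
    MemLp (fun ξ : Eu d => (((4 * Real.pi ^ 2 * ‖ξ‖ ^ 2 + m ^ 2)⁻¹ : ℝ) : ℂ)) ∞
      (volume : Measure (Eu d)) := by
  refine memLp_top_of_bound ?_ ((m ^ 2)⁻¹) (Filter.Eventually.of_forall fun ξ => ?_)
  · exact (by fun_prop : Measurable fun ξ : Eu d =>
      (((4 * Real.pi ^ 2 * ‖ξ‖ ^ 2 + m ^ 2)⁻¹ : ℝ) : ℂ)).aestronglyMeasurable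
  · rw [Complex.norm_real, Real.norm_eq_abs, abs_of_pos (by positivity)]
    exact inv_anti₀ (by positivity) (by nlinarith [sq_nonneg (Real.pi * ‖ξ‖)])

/-- `(Δ + m²)⁻¹` on complex-valued `L²(ℝ^d)`, where `Δ` is the nonnegative selfadjoint Laplacian:
with the Fourier transform `∫ e^(-2πi⟨x,ξ⟩) f(x) dx`, multiplication by `(4π²|ξ|² + m²)⁻¹`. -/
def resolventC (d : ℕ) {m : ℝ} (hm : 0 < m) :
    Lp ℂ 2 (volume : Measure (Eu d)) →L[ℂ] Lp ℂ 2 (volume : Measure (Eu d)) :=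
  ((Lp.fourierTransformₗᵢ (Eu d) ℂ).symm : _ →L[ℂ] _) ∘L
    ((ContinuousLinearMap.mul ℂ ℂ).holderL volume ∞ 2 2 ((resolventSymbol_memLp d hm).toLp _)) ∘L
    ((Lp.fourierTransformₗᵢ (Eu d) ℂ) : _ →L[ℂ] _)

/-- `(Δ + m²)⁻¹` on real-valued `L²(ℝ^d)`. (The complex operator preserves real functions.) -/
def resolvent (d : ℕ) {m : ℝ} (hm : 0 < m) :
    Lp ℝ 2 (volume : Measure (Eu d)) →L[ℝ] Lp ℝ 2 (volume : Measure (Eu d)) :=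
  Complex.reCLM.compLpL 2 volume ∘L (resolventC d hm).restrictScalars ℝ ∘L
    Complex.ofRealCLM.compLpL 2 volume

open scoped Laplacian SchwartzMap FourierTransform in
/-- `resolventC` inverts `-∑ ∂_i² + m²`; this determines it, as such functions are dense in `L²`. -/
theorem resolventC_spec (d : ℕ) {m : ℝ} (hm : 0 < m) (f : 𝓢(Eu d, ℂ)) :
    resolventC d hm ((-Δ f + ((m ^ 2 : ℝ) : ℂ) • f).toLp 2) = f.toLp 2 := by
  set g := -Δ f + ((m ^ 2 : ℝ) : ℂ) • f with hg
  have hF : ∀ ξ, (𝓕 g) ξ = ((4 * Real.pi ^ 2 * ‖ξ‖ ^ 2 + m ^ 2 : ℝ) : ℂ) * (𝓕 f) ξ := by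
    intro ξ
    have h1 : (𝓕 (Δ f)) ξ = ((-(2 * Real.pi) ^ 2 * ‖ξ‖ ^ 2 : ℝ) : ℂ) * (𝓕 f) ξ := by
      rw [SchwartzMap.laplacian_eq_fourierMultiplierCLM, FourierTransform.fourier_smul,
        SchwartzMap.fourierMultiplierCLM_apply, FourierTransform.fourier_fourierInv_eq,
        SchwartzMap.smul_apply, SchwartzMap.smulLeftCLM_apply_apply (by fun_prop)]
      simp
      ring
    have h2 : 𝓕 g = -𝓕 (Δ f) + ((m ^ 2 : ℝ) : ℂ) • 𝓕 f := by
      rw [hg, FourierTransform.fourier_add, FourierTransform.fourier_smul,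
        FourierTransform.fourier_neg]
    rw [h2, SchwartzMap.add_apply, SchwartzMap.neg_apply, SchwartzMap.smul_apply, h1]
    push_cast
    simp
    ring
  change (Lp.fourierTransformₗᵢ (Eu d) ℂ).symm _ = _
  rw [LinearIsometryEquiv.symm_apply_eq]
  change (ContinuousLinearMap.mul ℂ ℂ).holder 2 ((resolventSymbol_memLp d hm).toLp _)
    (𝓕 (g.toLp 2)) = 𝓕 (f.toLp 2)
  rw [SchwartzMap.toLp_fourier_eq, SchwartzMap.toLp_fourier_eq]
  ext1
  filter_upwards [(ContinuousLinearMap.mul ℂ ℂ).coeFn_holder (r := 2)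
      ((resolventSymbol_memLp d hm).toLp _) ((𝓕 g).toLp 2),
    (resolventSymbol_memLp d hm).coeFn_toLp, (𝓕 g).coeFn_toLp 2 volume,
    (𝓕 f).coeFn_toLp 2 volume] with ξ h1 h2 h3 h4
  rw [h1, h2, h3, h4, hF, ContinuousLinearMap.mul_apply', ← mul_assoc, ← Complex.ofReal_mul,
    inv_mul_cancel₀ (by positivity), Complex.ofReal_one, one_mul]

/-- The covariance `C_{S,k} = U_α U_{β_k} (Δ + m²)⁻¹ U_{β_k}⁻¹ U_α⁻¹` on `L²(𝕊_p^d)`. -/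
def covS (d : ℕ) {m : ℝ} (hm : 0 < m) (k : ℕ+) :
    Lp ℝ 2 (psphMeas d) →L[ℝ] Lp ℝ 2 (psphMeas d) :=
  (UAlpha d : Lp ℝ 2 (volume : Measure (Eu d)) →L[ℝ] Lp ℝ 2 (psphMeas d)) ∘L
    (UBeta d k : Lp ℝ 2 (volume : Measure (Eu d)) →L[ℝ] Lp ℝ 2 (volume : Measure (Eu d))) ∘L resolvent d hm ∘L
    ((UBeta d k).symm :
      Lp ℝ 2 (volume : Measure (Eu d)) →L[ℝ] Lp ℝ 2 (volume : Measure (Eu d))) ∘L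
    ((UAlpha d).symm : Lp ℝ 2 (psphMeas d) →L[ℝ] Lp ℝ 2 (volume : Measure (Eu d)))

/-- The covariance `C̃_{S,k} = J C_{S,k} J*` on `L²(𝕊^d)`. -/
def covSTilde (d : ℕ) {m : ℝ} (hm : 0 < m) (k : ℕ+) :
    Lp ℝ 2 (sphMeas d) →L[ℝ] Lp ℝ 2 (sphMeas d) :=
  (extendL2 d).toContinuousLinearMap ∘L covS d hm k ∘L
    ContinuousLinearMap.adjoint (extendL2 d).toContinuousLinearMap

/-- The space `𝓓(ℝ^d)` of real test functions, with Mathlib's canonical LF topology. -/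
abbrev RTest (d : ℕ) : Type := TestFunction (⊤ : TopologicalSpace.Opens (Eu d)) ℝ ⊤

/-- The space `𝓓(𝕊^d)` of smooth real functions on the sphere. -/
abbrev STest (d : ℕ) : Type := C^∞⟮𝓡 d, Sph d; 𝓘(ℝ, ℝ), ℝ⟯

/-- The `C^∞` topology: uniform convergence, on the compact subsets of every chart, of the
derivatives of every order. -/
instance STest.topologicalSpace (d : ℕ) : TopologicalSpace (STest d) :=
  ⨅ (x : Sph d) (n : ℕ), TopologicalSpace.induced
    (fun f : STest d =>
      UniformOnFun.ofFun {K : Set (Eu d) | IsCompact K ∧ K ⊆ (extChartAt (𝓡 d) x).target}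
        (iteratedFDeriv ℝ n (f ∘ (extChartAt (𝓡 d) x).symm)))
    inferInstance

instance sphMeas.isFiniteMeasure (d : ℕ) : IsFiniteMeasure (sphMeas d) := by unfold sphMeas; infer_instance

/-- The class in `L²(𝕊^d)` of a smooth function. -/
def STest.toL2 {d : ℕ} (f : STest d) : Lp ℝ 2 (sphMeas d) :=
  ContinuousMap.toLp 2 (sphMeas d) ℝ ⟨f, f.contMDiff.continuous⟩

section CharFunctional

variable (V : Type*) [AddCommGroup V] [Module ℝ V] [TopologicalSpace V]

/-- Duals carry the weak* topology and its Borel sets. -/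
instance weakDualMeasurableSpace : MeasurableSpace (WeakDual ℝ V) := borel _
instance weakDualBorelSpace : BorelSpace (WeakDual ℝ V) := ⟨rfl⟩

variable {V}

/-- The characteristic functional `S_μ(f) = ∫ exp(i φ(f)) dμ(φ)`. -/
def charFunctional (μ : Measure (WeakDual ℝ V)) (f : V) : ℂ :=
  ∫ φ, Complex.exp (Complex.I * ((φ f : ℝ) : ℂ)) ∂μ

end CharFunctional

/-- `U_{β_k} f = k^(d/2) f(k ·)` on test functions. -/
def scaleTest {d : ℕ} (k : ℕ+) (f : RTest d) : RTest d where
  toFun y := (k : ℝ) ^ ((d : ℝ) / 2) * f ((k : ℝ) • y)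
  contDiff' := contDiff_const.mul (f.contDiff.comp (contDiff_const_smul _))
  hasCompactSupport' :=
    (f.hasCompactSupport.comp_smul (c := (k : ℝ)) (by exact_mod_cast k.pos.ne')).mul_left
  tsupport_subset' := Set.subset_univ _

/-- `U_α f` vanishes near the north pole, so it is smooth on the whole sphere. -/
lemma contMDiff_transfer {d : ℕ} (f : RTest d) :
    ContMDiff (𝓡 d) 𝓘(ℝ, ℝ) ∞ (extendZero fun x : PSph d =>
      stereoFactor x ^ ((d : ℝ) / 2) * f (stereo d x)) := by
  intro x
  by_cases hx : x = northPole d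
  · obtain ⟨R, hR⟩ := f.hasCompactSupport.isBounded.subset_ball (0 : Eu d)
    have hev : extendZero (fun x : PSph d => stereoFactor x ^ ((d : ℝ) / 2) * f (stereo d x))
        =ᶠ[nhds x] fun _ => (0 : ℝ) := by
      have hcont : Continuous fun y : Sph d => (1 - (y : Eu (d + 1)) (Fin.last d)) * (R ^ 2 + 1) := by
        fun_prop
      have h0 : (1 - (x : Eu (d + 1)) (Fin.last d)) * (R ^ 2 + 1) < 2 := by
        simp [hx, northPole]
      filter_upwards [hcont.continuousAt.eventually_lt_const h0] with y hy
      by_cases hyN : y = northPole d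
      · refine Function.extend_apply' (f := (Subtype.val : PSph d → Sph d)) _ (0 : Sph d → ℝ) y ?_
        rintro ⟨z, rfl⟩
        exact z.2 hyN
      · have h1 := extendZero_val (fun x : PSph d => stereoFactor x ^ ((d : ℝ) / 2) *
          f (stereo d x)) ⟨y, hyN⟩
        rw [h1]
        have h2 : f (stereo d ⟨y, hyN⟩) = 0 := by
          by_contra hne
          have h3 := hR (subset_tsupport _ hne)
          rw [mem_ball_zero_iff] at h3
          have h4 : ‖stereo d ⟨y, hyN⟩‖ ^ 2 + 1 = 2 / (1 - (y : Eu (d + 1)) (Fin.last d)) :=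
            norm_stereoFun_sq hyN
          have h5 : 0 < 1 - (y : Eu (d + 1)) (Fin.last d) := by linarith [last_lt_one hyN]
          rw [eq_div_iff h5.ne'] at h4
          have h6 : ‖stereo d ⟨y, hyN⟩‖ ^ 2 ≤ R ^ 2 :=
            pow_le_pow_left₀ (norm_nonneg _) h3.le 2
          nlinarith
        rw [h2, mul_zero]
    exact contMDiffAt_const.congr_of_eventuallyEq hev
  · have hev : extendZero (fun x : PSph d => stereoFactor x ^ ((d : ℝ) / 2) * f (stereo d x))
        =ᶠ[nhds x] (fun z : Eu (d + 1) => ((1 - z (Fin.last d))⁻¹) ^ ((d : ℝ) / 2) *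
          f (stereoFun z)) ∘ (Subtype.val : Sph d → Eu (d + 1)) := by
      filter_upwards [isOpen_ne.mem_nhds hx] with y hy
      exact extendZero_val _ ⟨y, hy⟩
    refine ContMDiffAt.congr_of_eventuallyEq ?_ hev
    have hpos : 0 < 1 - (x : Eu (d + 1)) (Fin.last d) := by linarith [last_lt_one hx]
    have hlast : ∀ i, ContDiffAt ℝ ∞ (fun z : Eu (d + 1) => z i) (x : Eu (d + 1)) := fun i =>
      (EuclideanSpace.proj i : Eu (d + 1) →L[ℝ] ℝ).contDiff.contDiffAt
    have h1 : ContDiffAt ℝ ∞ (fun z : Eu (d + 1) => 1 - z (Fin.last d)) (x : Eu (d + 1)) :=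
      contDiffAt_const.sub (hlast _)
    have h2 : ContDiffAt ℝ ∞ (stereoFun (d := d)) (x : Eu (d + 1)) := by
      rw [contDiffAt_euclidean]
      exact fun i => (hlast _).div h1 hpos.ne'
    have h3 : ContDiffAt ℝ ∞ (fun z : Eu (d + 1) => ((1 - z (Fin.last d))⁻¹) ^ ((d : ℝ) / 2) *
        f (stereoFun z)) (x : Eu (d + 1)) :=
      ((h1.inv hpos.ne').rpow_const_of_ne (inv_pos.2 hpos).ne').mul
        (f.contDiff.contDiffAt.comp _ h2)
    exact h3.contMDiffAt.comp x (contMDiff_coe_sphere x)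

/-- `U_α f = Λ_α^(d/2) (f ∘ α)` on test functions, extended by zero to a smooth function on the
whole sphere. -/
def stereoTest {d : ℕ} (f : RTest d) : STest d := ⟨_, contMDiff_transfer f⟩

lemma RTest.memLp {d : ℕ} (f : RTest d) : MemLp f 2 (volume : Measure (Eu d)) :=
  f.continuous.memLp_of_hasCompactSupport f.hasCompactSupport

/-- On test functions, the operators on `L²` act as the maps of test functions. -/
theorem toL2_stereoTest_scaleTest {d : ℕ} (k : ℕ+) (f : RTest d) :
    (stereoTest (scaleTest k f)).toL2 = extendL2 d (UAlpha d (UBeta d k (f.memLp.toLp f))) := by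
  have h1 : UBeta d k (f.memLp.toLp f) =ᵐ[volume] scaleTest k f := by
    have hk : (0 : ℝ) < (k : ℕ) := by exact_mod_cast k.pos
    filter_upwards [conformalIsometry_coeFn (isConformalVol_scale d hk) (f.memLp.toLp f),
      (isConformalVol_scale d hk).ae_comp f.memLp.coeFn_toLp] with x h1 h2
    refine h1.trans ?_
    rw [h2]
    rfl
  have h2 : UAlpha d (UBeta d k (f.memLp.toLp f)) =ᵐ[psphMeas d] fun x =>
      stereoFactor x ^ ((d : ℝ) / 2) * scaleTest k f (stereo d x) := by
    filter_upwards [conformalIsometry_coeFn (isConformalVol_stereo d)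
      (UBeta d k (f.memLp.toLp f)), (isConformalVol_stereo d).ae_comp h1] with x h3 h4
    refine h3.trans ?_
    rw [h4]
  ext1
  refine (ContinuousMap.coeFn_toLp (sphMeas d) _).trans ?_
  exact (extendZero_ae h2).symm.trans
    (memLp_extendZero (Lp.memLp (UAlpha d (UBeta d k (f.memLp.toLp f))))).coeFn_toLp.symm

/-- A Radon probability measure: Borel sets are approximated from inside by compact sets. -/
structure IsRadonProb {X : Type*} [TopologicalSpace X] [MeasurableSpace X] (μ : Measure X) :
    Prop where
  isProb : IsProbabilityMeasure μ
  inner : μ.InnerRegular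

/-- `γ` is the mean zero Gaussian probability measure on `𝓓'(𝕊^d)` with covariance `C`, i.e.
`S_γ(f) = exp(-⟨C f, f⟩ / 2)`. -/
structure IsGaussianWithCov {d : ℕ} (C : Lp ℝ 2 (sphMeas d) →L[ℝ] Lp ℝ 2 (sphMeas d))
    (γ : Measure (WeakDual ℝ (STest d))) : Prop where
  radon : IsRadonProb γ
  charFunctional_eq : ∀ f : STest d, charFunctional γ f =
    Complex.exp (-(1 / 2 * inner ℝ (C f.toL2) f.toL2 : ℝ))

end ScalingLimit

end

open ScalingLimit

/-! ### Characteristic functions and the `L²` distance -/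

section CharacteristicFunctions

open Filter Topology

variable {Ω : Type*} [MeasurableSpace Ω]

/-! Tested against `U_α U_{β_k} f`, the Gaussian field has variance `⟨(Δ_E + m²)⁻¹ f, f⟩` for every
`k`, because the unitaries cancel; this is at most `m⁻² ‖f‖²` (`inner_covSTilde_stereoTest_le`). A
centred normal variable has its `L⁴` norm proportional to its standard deviation. The hypothesis,
applied to truncations of the squared field, bounds second moments under `μ^S_k` by Gaussian fourth
moments. Hence the field at `f` has norm at most `C ‖f‖` in `L²(μ^S_k)`, with `C` independent of `k`
and `f` (`exists_eLpNorm_eval_le`). Since `|e^(ix) - e^(iy)| ≤ |x - y|`, all the functionals are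
`C`-Lipschitz for the `L²(ℝ^d)` norm, which is continuous on `𝓓(ℝ^d)`; this gives equicontinuity.

For the limit, take a sequence of test functions dense in `L²(ℝ^d)`. The joint laws of the field at
these functions are tight on `ℝ^ℕ` by Chebyshev, and Prokhorov's theorem yields a subsequence
converging to a law `ν`. The moment bound survives in the limit, so the coordinates extend to a
continuous linear map `Y : L²(ℝ^d) → L²(ν)`, and the Lipschitz bound spreads the convergence to
every `f` (`exists_subseq_tendsto_law`).

It remains to realise `Y` by a measure on distributions, a concrete form of Minlos' theorem. Fourier
inversion with polynomial weights factors the inclusion `𝓓 → L²` as `A ∘ T`, with `T` continuous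
into `H = L²(ℝ^d, ℂ)` and `A` Hilbert-Schmidt. Then `Y ∘ A` is represented by a random vector `Z` in
`H` (`exists_random_vector`), and `f ↦ ⟨Z, T f⟩` is a random distribution with Radon law
(`exists_radon_of_random_functional`). Equicontinuity turns pointwise convergence into uniform
convergence on compact sets. -/

lemma integrable_exp_I_mul {P : Measure Ω} [IsProbabilityMeasure P] {U : Ω → ℝ}
    (hU : AEMeasurable U P) : Integrable (fun w => Complex.exp (Complex.I * (U w : ℂ))) P := by
  refine Integrable.of_bound (C := 1) ?_ (Eventually.of_forall fun w => ?_)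
  · exact (Complex.measurable_exp.comp_aemeasurable
      ((Complex.measurable_ofReal.comp_aemeasurable hU).const_mul _)).aestronglyMeasurable
  · rw [mul_comm, Complex.norm_exp_ofReal_mul_I]

/-- Factoring out the unimodular `e^(iy)` leaves `|e^(it) - 1| ≤ |t|` with `t = x - y`. -/
lemma norm_exp_I_mul_sub_le (x y : ℝ) :
    ‖Complex.exp (Complex.I * (x : ℂ)) - Complex.exp (Complex.I * (y : ℂ))‖ ≤ ‖x - y‖ := by
  have h : Complex.exp (Complex.I * (x : ℂ)) - Complex.exp (Complex.I * (y : ℂ)) =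
      Complex.exp ((y : ℂ) * Complex.I) * (Complex.exp (Complex.I * ((x - y : ℝ) : ℂ)) - 1) := by
    rw [mul_sub, ← Complex.exp_add, mul_one, mul_comm (y : ℂ)]
    push_cast
    ring_nf
  rw [h, norm_mul, Complex.norm_exp_ofReal_mul_I, one_mul]
  exact Real.norm_exp_I_mul_ofReal_sub_one_le

/-- Characteristic functions of random variables that are close in `L²` are close. -/
lemma norm_integral_exp_I_mul_sub_le {P : Measure Ω} [IsProbabilityMeasure P] {U W : Ω → ℝ}
    (hU : AEMeasurable U P) (hW : AEMeasurable W P) {C : ℝ} (hC : 0 ≤ C)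
    (h : eLpNorm (U - W) 2 P ≤ ENNReal.ofReal C) :
    ‖∫ w, Complex.exp (Complex.I * (U w : ℂ)) ∂P - ∫ w, Complex.exp (Complex.I * (W w : ℂ)) ∂P‖
      ≤ C := by
  rw [← integral_sub (integrable_exp_I_mul hU) (integrable_exp_I_mul hW)]
  have h1 : ‖∫ w, (Complex.exp (Complex.I * (U w : ℂ)) - Complex.exp (Complex.I * (W w : ℂ))) ∂P‖ₑ
      ≤ ENNReal.ofReal C := by
    refine (enorm_integral_le_lintegral_enorm _).trans ?_
    refine le_trans (lintegral_mono (g := fun w => ‖(U - W) w‖ₑ) fun w => ?_) ?_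
    · exact enorm_le_iff_norm_le.2 (norm_exp_I_mul_sub_le _ _)
    · rw [← eLpNorm_one_eq_lintegral_enorm]
      exact (eLpNorm_le_eLpNorm_of_exponent_le one_le_two
        (hU.sub hW).aestronglyMeasurable).trans h
  rwa [← ofReal_norm, ENNReal.ofReal_le_ofReal_iff hC] at h1

end CharacteristicFunctions

/-! ### Tightness on `ℝ^ℕ` -/

section LimitField

open Filter Topology

/-- Supplies the radius beyond which Chebyshev's inequality, for a variable of `L²` norm at most
`B`, leaves mass at most `δ`. -/
lemma exists_pos_inv_sq_mul_sq_le (B : ℝ) (hB : 0 ≤ B) {δ : ℝ≥0∞} (hδ : 0 < δ) :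
    ∃ R : ℝ, 0 < R ∧ (ENNReal.ofReal R)⁻¹ ^ (2 : ℝ) * ENNReal.ofReal B ^ (2 : ℝ) ≤ δ := by
  obtain ⟨s, hs0, hs⟩ := ENNReal.lt_iff_exists_real_btwn.1 hδ
  have hspos : 0 < s := by simpa using hs.1
  -- This makes `B / R ≤ min s 1`; the minimum with `1` ensures that squaring does not increase the
  -- bound, and `+ 1` keeps `R` positive when `B = 0`.
  refine ⟨B / min s 1 + 1, by positivity, ?_⟩
  have hm : 0 < min s 1 := lt_min hspos one_pos
  have hR : 0 < B / min s 1 + 1 := by positivity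
  rw [← ENNReal.mul_rpow_of_nonneg _ _ zero_le_two, ← ENNReal.ofReal_inv_of_pos hR,
    ← ENNReal.ofReal_mul (by positivity), ENNReal.ofReal_rpow_of_nonneg (by positivity) zero_le_two]
  refine le_trans (ENNReal.ofReal_le_ofReal ?_) hs.2.le
  have h1 : (B / min s 1 + 1)⁻¹ * B ≤ min s 1 := by
    rw [inv_mul_le_iff₀ hR, add_mul, div_mul_cancel₀ _ hm.ne']
    linarith
  have h0 : 0 ≤ (B / min s 1 + 1)⁻¹ * B := by positivity
  rw [Real.rpow_two]
  calc _ ≤ (min s 1) ^ 2 := pow_le_pow_left₀ h0 h1 2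
    _ ≤ min s 1 * 1 := by rw [sq]; exact mul_le_mul_of_nonneg_left (min_le_right _ _) hm.le
    _ ≤ s := by rw [mul_one]; exact min_le_left _ _

/-- Probability measures on `ℝ^ℕ` whose coordinates are bounded in `L²` are tight. -/
lemma isTightMeasureSet_of_eLpNorm_coord_le {S : Set (Measure (ℕ → ℝ))} (B : ℕ → ℝ)
    (hB : ∀ i, 0 ≤ B i)
    (h : ∀ μ ∈ S, ∀ i, eLpNorm (fun x : ℕ → ℝ => x i) 2 μ ≤ ENNReal.ofReal (B i)) :
    IsTightMeasureSet S := by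
  rw [isTightMeasureSet_iff_exists_isCompact_measure_compl_le]
  intro ε hε
  obtain ⟨δ, hδ, hsum⟩ := ENNReal.exists_pos_sum_of_countable hε.ne' ℕ
  choose R hR hRδ using fun i => exists_pos_inv_sq_mul_sq_le (B i) (hB i)
    (δ := δ i) (by exact_mod_cast hδ i)
  -- A product of compact intervals, compact by Tychonoff; a point outside violates some coordinate
  -- bound, and the `i`-th violation costs at most `δ i`.
  refine ⟨Set.univ.pi fun i => Metric.closedBall 0 (R i),
    isCompact_univ_pi fun i => isCompact_closedBall _ _, fun μ hμ => ?_⟩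
  have hsub : (Set.univ.pi fun i => Metric.closedBall (0 : ℝ) (R i))ᶜ ⊆
      ⋃ i, {x : ℕ → ℝ | ENNReal.ofReal (R i) ≤ ‖x i‖ₑ} := by
    intro x hx
    simp only [Set.mem_compl_iff, Set.mem_pi, Set.mem_univ, true_implies, not_forall,
      mem_closedBall_zero_iff, not_le] at hx
    obtain ⟨i, hi⟩ := hx
    refine Set.mem_iUnion.2 ⟨i, ?_⟩
    change ENNReal.ofReal (R i) ≤ ‖x i‖ₑ
    rw [← ofReal_norm]
    exact ENNReal.ofReal_le_ofReal hi.le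
  refine (measure_mono hsub).trans ((measure_iUnion_le _).trans (le_trans ?_ hsum.le))
  refine ENNReal.tsum_le_tsum fun i => ?_
  have h2 := meas_ge_le_mul_pow_eLpNorm_enorm μ (p := 2) two_ne_zero ENNReal.ofNat_ne_top
    (f := fun x : ℕ → ℝ => x i) (measurable_pi_apply i).aestronglyMeasurable
    (ε := ENNReal.ofReal (R i)) (by simpa using hR i) (by simp)
  refine h2.trans (le_trans ?_ (hRδ i))
  simp only [ENNReal.toReal_ofNat]
  gcongr
  exact h μ hμ i

end LimitField

/-! ### Extraction of a limit in law -/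

section LimitField

open Filter Topology

/-- A sequence with dense image under a map of dense range. -/
lemma exists_denseRange_comp {V L : Type*} [TopologicalSpace L] [TopologicalSpace.PseudoMetrizableSpace L]
    [SecondCountableTopology L] [Nonempty V] {j : V → L}
    (hj : DenseRange j) : ∃ e : ℕ → V, DenseRange (j ∘ e) := by
  obtain ⟨t, ht, htc, htd⟩ := Dense.exists_countable_dense_subset hj
  have hne : t.Nonempty := by
    by_contra h
    rw [Set.not_nonempty_iff_eq_empty] at h
    subst h
    have := htd.nonempty_iff.2 ⟨j (Classical.arbitrary V)⟩
    simp at this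
  obtain ⟨u, hu⟩ := htc.exists_eq_range hne
  choose e he using fun i => ht (hu ▸ Set.mem_range_self i : u i ∈ t)
  refine ⟨e, ?_⟩
  have : j ∘ e = u := funext he
  rw [this]
  change Dense (Set.range u)
  rwa [← hu]

variable {V L : Type*} [AddCommGroup V] [Module ℝ V] [NormedAddCommGroup L] [NormedSpace ℝ L]

/-- The lower semicontinuity of `L²` norms under weak convergence. -/
lemma eLpNorm_two_le_of_tendsto {E : Type*} [TopologicalSpace E] [MeasurableSpace E]
    [BorelSpace E] [HasOuterApproxClosed E] {μs : ℕ → ProbabilityMeasure E}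
    {μ : ProbabilityMeasure E} (hμ : Tendsto μs atTop (𝓝 μ)) {F : E → ℝ} (hF : Continuous F)
    {C : ℝ≥0∞} (hC : ∀ n, eLpNorm F 2 (μs n : Measure E) ≤ C) :
    eLpNorm F 2 (μ : Measure E) ≤ C := by
  have hsq : ∀ ν : Measure E, eLpNorm F 2 ν = (∫⁻ x, ENNReal.ofReal (F x ^ 2) ∂ν) ^ ((2 : ℝ)⁻¹) := by
    intro ν
    rw [eLpNorm_eq_lintegral_rpow_enorm_toReal two_ne_zero ENNReal.ofNat_ne_top]
    simp only [ENNReal.toReal_ofNat, one_div]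
    congr 1
    refine lintegral_congr fun x => ?_
    rw [← ofReal_norm, ENNReal.ofReal_rpow_of_nonneg (norm_nonneg _) zero_le_two, Real.rpow_two,
      Real.norm_eq_abs, sq_abs]
  -- `F ^ 2` may be unbounded, so weak convergence gives only this inequality, via the portmanteau
  -- bound on open sets.
  have h1 := lintegral_le_liminf_lintegral_of_forall_isOpen_measure_le_liminf_measure
    (μ := (μ : Measure E)) (μs := fun n => (μs n : Measure E)) (f := fun x => F x ^ 2)
    (hF.pow 2) (fun x => sq_nonneg _)
    (fun G hG => ProbabilityMeasure.le_liminf_measure_open_of_tendsto hμ hG)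
  have h2 : ∀ n, ∫⁻ x, ENNReal.ofReal (F x ^ 2) ∂(μs n : Measure E) ≤ C ^ (2 : ℝ) := by
    intro n
    have := hC n
    rwa [hsq, ENNReal.rpow_inv_le_iff two_pos] at this
  rw [hsq, ENNReal.rpow_inv_le_iff two_pos]
  refine h1.trans ?_
  refine (liminf_le_liminf (Eventually.of_forall h2)).trans ?_
  simp

/-- A sequence of random linear functionals, uniformly bounded in `L²` with respect to a separable
norm, has a subsequence that converges in law to a random linear functional. -/
theorem exists_subseq_tendsto_law [SecondCountableTopology L] {j : V →ₗ[ℝ] L}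
    (hj : DenseRange j) {Ω : ℕ → Type*} [∀ n, MeasurableSpace (Ω n)] (P : ∀ n, Measure (Ω n))
    [∀ n, IsProbabilityMeasure (P n)] (X : ∀ n, V → Ω n → ℝ) (hX : ∀ n f, Measurable (X n f))
    (hadd : ∀ n f g, X n (f + g) = X n f + X n g) (hsmul : ∀ n (c : ℝ) f, X n (c • f) = c • X n f)
    {C : ℝ} (hC0 : 0 ≤ C) (hC : ∀ n f, eLpNorm (X n f) 2 (P n) ≤ ENNReal.ofReal (C * ‖j f‖)) :
    ∃ (φ : ℕ → ℕ) (ν : Measure (ℕ → ℝ)) (_ : IsProbabilityMeasure ν) (Y : L →L[ℝ] Lp ℝ 2 ν),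
      StrictMono φ ∧ (∀ h, ‖Y h‖ ≤ C * ‖h‖) ∧
      ∀ f, Tendsto (fun n => ∫ w, Complex.exp (Complex.I * (X (φ n) f w : ℂ)) ∂(P (φ n))) atTop
        (𝓝 (∫ w, Complex.exp (Complex.I * (Y (j f) w : ℂ)) ∂ν)) := by
  obtain ⟨e, he⟩ := exists_denseRange_comp hj
  have hmeas : ∀ n, Measurable fun w : Ω n => fun i => X n (e i) w :=
    fun n => measurable_pi_lambda _ fun i => hX n (e i)
  let law : ∀ n, ProbabilityMeasure (ℕ → ℝ) := fun n =>
    ⟨(P n).map fun w i => X n (e i) w, Measure.isProbabilityMeasure_map (hmeas n).aemeasurable⟩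
  have hlaw : ∀ n, (law n : Measure (ℕ → ℝ)) = (P n).map fun w i => X n (e i) w := fun n => rfl
  have htight : IsTightMeasureSet
      {((μ : ProbabilityMeasure (ℕ → ℝ)) : Measure (ℕ → ℝ)) | μ ∈ Set.range law} := by
    refine isTightMeasureSet_of_eLpNorm_coord_le (fun i => C * ‖j (e i)‖)
      (fun i => by positivity) ?_
    rintro _ ⟨_, ⟨n, rfl⟩, rfl⟩ i
    rw [hlaw, eLpNorm_map_measure (measurable_pi_apply i).aestronglyMeasurable
      (hmeas n).aemeasurable]
    exact hC n (e i)
  obtain ⟨ν, -, φ, hφ, hlim⟩ := (isCompact_closure_of_isTightMeasureSet htight).tendsto_subseq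
    (x := law) fun n => subset_closure ⟨n, rfl⟩
  -- finite linear combinations of the coordinates
  have hXsum : ∀ n (c : ℕ →₀ ℝ), X n (Finsupp.linearCombination ℝ e c) =
      fun w => c.sum fun i a => a * X n (e i) w := by
    intro n c
    -- Linearity of the field holds for every `w`, not just almost everywhere, so finite sums pass
    -- through exactly.
    let T : V →ₗ[ℝ] (Ω n → ℝ) := ⟨⟨X n, hadd n⟩, hsmul n⟩
    have : T (Finsupp.linearCombination ℝ e c) = c.sum fun i a => a • T (e i) := by
      rw [Finsupp.linearCombination_apply, map_finsuppSum]
      simp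
    funext w
    have := congrFun this w
    simp only [Finsupp.sum, Finset.sum_apply, Pi.smul_apply, smul_eq_mul] at this
    exact this
  have hbound : ∀ c : ℕ →₀ ℝ, eLpNorm (fun x : ℕ → ℝ => c.sum fun i a => a * x i) 2
      (ν : Measure (ℕ → ℝ)) ≤ ENNReal.ofReal (C * ‖j (Finsupp.linearCombination ℝ e c)‖) := by
    intro c
    have hcont : Continuous fun x : ℕ → ℝ => c.sum fun i a => a * x i :=
      continuous_finsetSum _ fun i _ => by fun_prop
    refine eLpNorm_two_le_of_tendsto hlim hcont fun n => ?_
    rw [Function.comp_apply, hlaw, eLpNorm_map_measure hcont.aestronglyMeasurable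
      (hmeas _).aemeasurable]
    refine le_trans (le_of_eq ?_) (hC (φ n) (Finsupp.linearCombination ℝ e c))
    rw [hXsum]
    rfl
  have hcoord : ∀ i, MemLp (fun x : ℕ → ℝ => x i) 2 (ν : Measure (ℕ → ℝ)) := by
    intro i
    refine ⟨(measurable_pi_apply i).aestronglyMeasurable, ?_⟩
    have := hbound (Finsupp.single i 1)
    simp only [Finsupp.sum_single_index, zero_mul, one_mul] at this
    exact this.trans_lt ENNReal.ofReal_lt_top
  -- The `e i` may be linearly dependent, so the map is first defined on formal combinations, where
  -- no relation has to be respected.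
  let Y₀ : (ℕ →₀ ℝ) →ₗ[ℝ] Lp ℝ 2 (ν : Measure (ℕ → ℝ)) :=
    Finsupp.linearCombination ℝ fun i => (hcoord i).toLp _
  let j₀ : (ℕ →₀ ℝ) →ₗ[ℝ] L := j ∘ₗ Finsupp.linearCombination ℝ e
  have hj₀ : DenseRange j₀ := by
    refine he.mono ?_
    rintro _ ⟨i, rfl⟩
    exact ⟨Finsupp.single i 1, by simp [j₀]⟩
  have hY₀ : ∀ c, Y₀ c =ᵐ[(ν : Measure (ℕ → ℝ))] fun x => c.sum fun i a => a * x i := by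
    intro c
    have h1 : ∀ᵐ x ∂(ν : Measure (ℕ → ℝ)), ∀ i, ((hcoord i).toLp _ : (ℕ → ℝ) → ℝ) x = x i :=
      ae_all_iff.2 fun i => (hcoord i).coeFn_toLp
    have h2 : Y₀ c = ∑ i ∈ c.support, c i • (hcoord i).toLp _ := rfl
    have h3 : ∀ s : Finset ℕ, ⇑(∑ i ∈ s, c i • (hcoord i).toLp _) =ᵐ[(ν : Measure (ℕ → ℝ))]
        fun x => ∑ i ∈ s, c i * ((hcoord i).toLp _ : (ℕ → ℝ) → ℝ) x := by
      intro s
      induction s using Finset.induction_on with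
      | empty =>
        simp only [Finset.sum_empty]
        exact Lp.coeFn_zero _ _ _
      | insert a s ha ih =>
        rw [Finset.sum_insert ha]
        filter_upwards [Lp.coeFn_add (c a • (hcoord a).toLp _) (∑ i ∈ s, c i • (hcoord i).toLp _),
          Lp.coeFn_smul (c a) ((hcoord a).toLp _), ih] with x h4 h5 h6
        rw [h4, Pi.add_apply, h5, h6, Finset.sum_insert ha]
        rfl
    rw [h2]
    filter_upwards [h1, h3 c.support] with x h4 h5
    rw [h5]
    exact Finset.sum_congr rfl fun i _ => by rw [h4 i]
  have hY₀le : ∀ c, ‖Y₀ c‖ ≤ C * ‖j₀ c‖ := by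
    intro c
    rw [Lp.norm_def]
    refine ENNReal.toReal_le_of_le_ofReal (by positivity) ?_
    rw [eLpNorm_congr_ae (hY₀ c)]
    exact hbound c
  -- The bound `hY₀le` makes `Y₀` vanish on the kernel of `j₀`, so it descends to the dense range of
  -- `j₀` and extends to `L` by continuity.
  let Y := Y₀.extendOfNorm j₀
  have hYle : ∀ h, ‖Y h‖ ≤ C * ‖h‖ := LinearMap.norm_extendOfNorm_apply_le hj₀ C hY₀le
  have hYe : ∀ i, Y (j (e i)) =ᵐ[(ν : Measure (ℕ → ℝ))] fun x => x i := by
    intro i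
    have h1 : Y (j₀ (Finsupp.single i 1)) = Y₀ (Finsupp.single i 1) :=
      LinearMap.extendOfNorm_eq hj₀ ⟨C, hY₀le⟩ _
    have h2 : j₀ (Finsupp.single i 1) = j (e i) := by simp [j₀]
    rw [← h2, h1]
    refine (hY₀ _).trans (Eventually.of_forall fun x => ?_)
    simp
  refine ⟨φ, ν, inferInstance, Y, hφ, hYle, fun f => ?_⟩
  have hei : ∀ i, Tendsto
      (fun n => ∫ w, Complex.exp (Complex.I * (X (φ n) (e i) w : ℂ)) ∂(P (φ n))) atTop
        (𝓝 (∫ w, Complex.exp (Complex.I * (Y (j (e i)) w : ℂ)) ∂(ν : Measure (ℕ → ℝ)))) := by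
    intro i
    have hc : Continuous fun x : ℕ → ℝ => Complex.exp (Complex.I * (x i : ℂ)) := by fun_prop
    let F : BoundedContinuousFunction (ℕ → ℝ) ℂ := BoundedContinuousFunction.ofNormedAddCommGroup
      (fun x : ℕ → ℝ => Complex.exp (Complex.I * (x i : ℂ))) hc 1
      (fun x => by rw [mul_comm, Complex.norm_exp_ofReal_mul_I])
    -- At `f = e i` the claim is weak convergence tested on a single coordinate exponential.
    have h1 := (ProbabilityMeasure.tendsto_iff_forall_integral_rclike_tendsto ℂ).1 hlim F
    have h2 : ∫ w, Complex.exp (Complex.I * (Y (j (e i)) w : ℂ)) ∂(ν : Measure (ℕ → ℝ)) =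
        ∫ x, F x ∂(ν : Measure (ℕ → ℝ)) :=
      integral_congr_ae ((hYe i).mono fun x hx => by simp only [hx]; rfl)
    rw [h2]
    refine h1.congr fun n => ?_
    rw [Function.comp_apply, hlaw, integral_map (hmeas _).aemeasurable
      F.continuous.aestronglyMeasurable]
    rfl
  rw [Metric.tendsto_atTop]
  intro ε hε
  -- Replacing `f` by a nearby `e i` costs `ε / 4` before the limit and `ε / 4` in the limit; `C +
  -- 1` guards against `C = 0`.
  have hδ : 0 < ε / (4 * (C + 1)) := by positivity
  obtain ⟨i, hi⟩ := he.exists_dist_lt (j f) hδ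
  rw [Function.comp_apply, dist_eq_norm] at hi
  have hCi : C * ‖j f - j (e i)‖ ≤ ε / 4 := by
    calc C * ‖j f - j (e i)‖ ≤ (C + 1) * (ε / (4 * (C + 1))) := by gcongr; linarith
      _ = ε / 4 := by field_simp
  obtain ⟨N, hN⟩ := Metric.tendsto_atTop.1 (hei i) (ε / 4) (by positivity)
  refine ⟨N, fun n hn => ?_⟩
  have h1 := hN n hn
  rw [dist_eq_norm] at h1 ⊢
  have h2 : ‖∫ w, Complex.exp (Complex.I * (X (φ n) f w : ℂ)) ∂(P (φ n)) -
      ∫ w, Complex.exp (Complex.I * (X (φ n) (e i) w : ℂ)) ∂(P (φ n))‖ ≤ ε / 4 := by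
    refine norm_integral_exp_I_mul_sub_le (hX _ _).aemeasurable (hX _ _).aemeasurable
      (by positivity) ?_
    have hsub : X (φ n) f - X (φ n) (e i) = X (φ n) (f - e i) := by
      rw [sub_eq_add_neg f, hadd, ← neg_one_smul ℝ (e i), hsmul, neg_one_smul, sub_eq_add_neg]
    rw [hsub]
    refine (hC _ _).trans (ENNReal.ofReal_le_ofReal ?_)
    rwa [map_sub]
  have h3 : ‖∫ w, Complex.exp (Complex.I * (Y (j (e i)) w : ℂ)) ∂(ν : Measure (ℕ → ℝ)) -
      ∫ w, Complex.exp (Complex.I * (Y (j f) w : ℂ)) ∂(ν : Measure (ℕ → ℝ))‖ ≤ ε / 4 := by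
    refine norm_integral_exp_I_mul_sub_le (Lp.aestronglyMeasurable _).aemeasurable
      (Lp.aestronglyMeasurable _).aemeasurable (by positivity) ?_
    rw [← eLpNorm_congr_ae (Lp.coeFn_sub _ _), ← map_sub]
    have h4 := hYle (j (e i) - j f)
    rw [Lp.norm_def] at h4
    rw [← ENNReal.ofReal_toReal (Lp.eLpNorm_ne_top (Y (j (e i) - j f)))]
    refine ENNReal.ofReal_le_ofReal (h4.trans ?_)
    rwa [norm_sub_rev]
  have hsplit : ∀ a b c e : ℂ, ‖a - b‖ ≤ ε / 4 → ‖b - c‖ < ε / 4 → ‖c - e‖ ≤ ε / 4 →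
      ‖a - e‖ < ε := fun a b c e h4 h5 h6 => by
    have := norm_add₃_le (a := a - b) (b := b - c) (c := c - e)
    simp only [sub_add_sub_cancel] at this
    linarith
  exact hsplit _ _ _ _ h2 h1 h3

end LimitField

/-! ### Random vectors from Hilbert-Schmidt maps -/

section HilbertSchmidt

open Filter Topology

/-- An `L²`-limit and an almost everywhere limit agree. -/
lemma ae_eq_of_tendsto_Lp_of_tendsto_ae {Ω κ : Type*} [MeasurableSpace Ω] {ν : Measure Ω}
    {l : Filter κ} [l.NeBot] [l.IsCountablyGenerated] {F : κ → Lp ℝ 2 ν} {G : Lp ℝ 2 ν}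
    (hF : Tendsto F l (𝓝 G)) {g : Ω → ℝ}
    (hg : ∀ᵐ w ∂ν, Tendsto (fun k => F k w) l (𝓝 (g w))) : g =ᵐ[ν] G := by
  -- `L²` convergence implies convergence in measure, hence almost everywhere convergence along a
  -- sequence tending to `l`.
  obtain ⟨ns, hns, h⟩ := (tendstoInMeasure_of_tendsto_Lp hF).exists_seq_tendsto_ae'
  filter_upwards [h, hg] with w h1 h2
  exact tendsto_nhds_unique (h2.comp hns) h1

/-- A continuous random linear functional becomes a random vector after composition with a
Hilbert-Schmidt operator. -/
theorem exists_random_vector {Ω H L ι : Type*} [MeasurableSpace Ω] {ν : Measure Ω}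
    [NormedAddCommGroup H] [InnerProductSpace ℝ H] [CompleteSpace H] [MeasurableSpace H]
    [BorelSpace H] [SecondCountableTopology H]
    [NormedAddCommGroup L] [NormedSpace ℝ L] [Countable ι]
    (Y : L →L[ℝ] Lp ℝ 2 ν) (A : H →L[ℝ] L) (b : HilbertBasis ι ℝ H)
    (hA : Summable fun i => ‖A (b i)‖ ^ 2) :
    ∃ Z : Ω → H, AEMeasurable Z ν ∧ ∀ g, (fun w => inner ℝ (Z w) g) =ᵐ[ν] Y (A g) := by
  classical
  let X : ι → Lp ℝ 2 ν := fun i => Y (A (b i))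
  -- The expected sum of squares is at most `‖Y‖² ∑ ‖A (b i)‖²`; by Tonelli the coefficients are
  -- then almost surely square summable.
  have hsum : ∑' i, ∫⁻ w, ENNReal.ofReal (X i w ^ 2) ∂ν ≠ ⊤ := by
    have h1 : ∀ i, ∫⁻ w, ENNReal.ofReal (X i w ^ 2) ∂ν ≤ ENNReal.ofReal (‖Y‖ ^ 2 * ‖A (b i)‖ ^ 2) := by
      intro i
      have h2 : ∫⁻ w, ENNReal.ofReal (X i w ^ 2) ∂ν = ENNReal.ofReal (‖X i‖ ^ 2) := by
        have h3 : ‖X i‖ ^ 2 = ∫ w, X i w ^ 2 ∂ν := by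
          rw [← real_inner_self_eq_norm_sq, L2.inner_def]
          refine integral_congr_ae (Eventually.of_forall fun w => ?_)
          simp only [real_inner_self_eq_norm_sq, Real.norm_eq_abs, sq_abs]
        rw [h3, ofReal_integral_eq_lintegral_ofReal]
        · exact (Lp.memLp (X i)).integrable_sq
        · exact Eventually.of_forall fun w => sq_nonneg _
      rw [h2, ← mul_pow]
      exact ENNReal.ofReal_le_ofReal (pow_le_pow_left₀ (norm_nonneg _) (Y.le_opNorm _) 2)
    refine ne_top_of_le_ne_top ?_ (ENNReal.tsum_le_tsum h1)
    rw [← ENNReal.ofReal_tsum_of_nonneg (fun i => by positivity) (hA.mul_left _)]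
    exact ENNReal.ofReal_ne_top
  have hae : ∀ᵐ w ∂ν, Memℓp (fun i => X i w) 2 := by
    rw [← lintegral_tsum fun i => ((Lp.aestronglyMeasurable (X i)).aemeasurable.pow_const
      2).ennreal_ofReal] at hsum
    have hm : AEMeasurable (fun w => ∑' i, ENNReal.ofReal (X i w ^ 2)) ν :=
      AEMeasurable.tsum fun i =>
        ((Lp.aestronglyMeasurable (X i)).aemeasurable.pow_const 2).ennreal_ofReal
    filter_upwards [ae_lt_top' hm hsum] with w hw
    refine memℓp_gen ?_
    have h1 := ENNReal.summable_toReal hw.ne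
    simpa [ENNReal.toReal_ofReal, sq_nonneg] using h1
  -- The vector with coordinates `X i w` in the basis `b`; the value `0` occurs only on a null set.
  let Z : Ω → H := fun w =>
    if h : Memℓp (fun i => X i w) 2 then b.repr.symm ⟨fun i => X i w, h⟩ else 0
  have hZ : ∀ᵐ w ∂ν, HasSum (fun i => X i w • b i) (Z w) := by
    filter_upwards [hae] with w hw
    simp only [Z, dif_pos hw]
    exact b.hasSum_repr_symm ⟨fun i => X i w, hw⟩
  refine ⟨Z, ?_, fun g => ?_⟩
  · refine aemeasurable_of_tendsto_metrizable_ae atTop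
      (f := fun (s : Finset ι) w => ∑ i ∈ s, X i w • b i) (fun s => ?_) hZ
    refine Finset.aemeasurable_fun_sum s fun i _ => ?_
    exact (continuous_id.smul continuous_const).measurable.comp_aemeasurable
      (Lp.aestronglyMeasurable (X i)).aemeasurable
  -- Expanding `g` in the basis, the same partial sums converge to `Y (A g)` in `L²(ν)` and to `⟨Z,
  -- g⟩` almost everywhere.
  · have h1 : HasSum (fun i => inner ℝ (b i) g • X i) (Y (A g)) := by
      have h2 := (b.hasSum_repr g).mapL (Y ∘L A)
      simpa [b.repr_apply_apply, X] using h2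
    refine ae_eq_of_tendsto_Lp_of_tendsto_ae h1 ?_
    have h3 : ∀ᵐ w ∂ν, ∀ s : Finset ι, (∑ i ∈ s, inner ℝ (b i) g • X i : Lp ℝ 2 ν) w =
        ∑ i ∈ s, inner ℝ (b i) g * X i w := by
      refine ae_all_iff.2 fun s => ?_
      induction s using Finset.induction_on with
      | empty =>
        simp only [Finset.sum_empty]
        exact Lp.coeFn_zero _ _ _
      | insert a s ha ih =>
        rw [Finset.sum_insert ha]
        filter_upwards [Lp.coeFn_add (inner ℝ (b a) g • X a) (∑ i ∈ s, inner ℝ (b i) g • X i),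
          Lp.coeFn_smul (inner ℝ (b a) g) (X a), ih] with w h4 h5 h6
        rw [h4, Pi.add_apply, h5, h6, Finset.sum_insert ha]
        rfl
    filter_upwards [h3, hZ] with w h4 h5
    simp only [h4]
    have h6 := h5.mapL (innerSL ℝ g)
    simp only [map_smul, innerSL_apply_apply, smul_eq_mul] at h6
    rw [real_inner_comm]
    refine h6.congr fun s => Finset.sum_congr rfl fun i _ => ?_
    rw [real_inner_comm, mul_comm]

end HilbertSchmidt

/-! ### Covariances and linearity of the transfer to the sphere -/

namespace ScalingLimit

/-- The class in `L²(ℝ^d)` of a test function. -/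
noncomputable def RTest.toL2 {d : ℕ} : RTest d →ₗ[ℝ] Lp ℝ 2 (volume : Measure (Eu d)) where
  toFun f := f.memLp.toLp f
  map_add' _ _ := rfl
  map_smul' _ _ := rfl

/-- Plancherel reduces the bound to the pointwise estimate `(4π²|ξ|² + m²)⁻¹ ≤ m⁻²` on the symbol.
-/
lemma norm_resolventC_apply_le (d : ℕ) {m : ℝ} (hm : 0 < m)
    (f : Lp ℂ 2 (volume : Measure (Eu d))) : ‖resolventC d hm f‖ ≤ (m ^ 2)⁻¹ * ‖f‖ := by
  change ‖(Lp.fourierTransformₗᵢ (Eu d) ℂ).symm ((ContinuousLinearMap.mul ℂ ℂ).holder 2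
    ((resolventSymbol_memLp d hm).toLp _) (Lp.fourierTransformₗᵢ (Eu d) ℂ f))‖ ≤ _
  rw [LinearIsometryEquiv.norm_map, ← LinearIsometryEquiv.norm_map (Lp.fourierTransformₗᵢ (Eu d) ℂ) f]
  refine Lp.norm_le_mul_norm_of_ae_le_mul ?_
  filter_upwards [(ContinuousLinearMap.mul ℂ ℂ).coeFn_holder (r := 2)
      ((resolventSymbol_memLp d hm).toLp _) (Lp.fourierTransformₗᵢ (Eu d) ℂ f),
    (resolventSymbol_memLp d hm).coeFn_toLp] with ξ h1 h2
  rw [h1, h2, ContinuousLinearMap.mul_apply', norm_mul]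
  refine mul_le_mul_of_nonneg_right ?_ (norm_nonneg _)
  rw [Complex.norm_real, Real.norm_eq_abs, abs_of_pos (by positivity)]
  exact inv_anti₀ (by positivity) (by nlinarith [sq_nonneg (Real.pi * ‖ξ‖)])

lemma norm_resolvent_apply_le (d : ℕ) {m : ℝ} (hm : 0 < m)
    (f : Lp ℝ 2 (volume : Measure (Eu d))) : ‖resolvent d hm f‖ ≤ (m ^ 2)⁻¹ * ‖f‖ := by
  change ‖Complex.reCLM.compLp (resolventC d hm (Complex.ofRealCLM.compLp f))‖ ≤ _
  have h1 : ‖Complex.ofRealCLM.compLp f‖ ≤ 1 * ‖f‖ := by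
    simpa using Complex.ofRealCLM.norm_compLp_le f
  have h2 := Complex.reCLM.norm_compLp_le (resolventC d hm (Complex.ofRealCLM.compLp f))
  rw [Complex.reCLM_norm, one_mul] at h2
  refine h2.trans ((norm_resolventC_apply_le d hm _).trans ?_)
  rw [one_mul] at h1
  gcongr

/-- The covariance of the transferred test function is that of the test function. -/
lemma inner_covSTilde_stereoTest (d : ℕ) {m : ℝ} (hm : 0 < m) (k : ℕ+) (f : RTest d) :
    inner ℝ (covSTilde d hm k (stereoTest (scaleTest k f)).toL2)
      (stereoTest (scaleTest k f)).toL2 = inner ℝ (resolvent d hm f.toL2) f.toL2 := by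
  rw [toL2_stereoTest_scaleTest]
  change inner ℝ (extendL2 d (covS d hm k (ContinuousLinearMap.adjoint
    (extendL2 d).toContinuousLinearMap (extendL2 d (UAlpha d (UBeta d k f.toL2))))))
    (extendL2 d (UAlpha d (UBeta d k f.toL2))) = _
  -- `J` is isometric, so `J* J = 1`; the unitaries then cancel in pairs and no dependence on `k` is
  -- left.
  have hadj : ∀ g, ContinuousLinearMap.adjoint (extendL2 d).toContinuousLinearMap
      (extendL2 d g) = g := by
    intro g
    refine ext_inner_right ℝ fun h => ?_
    rw [ContinuousLinearMap.adjoint_inner_left]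
    exact (extendL2 d).inner_map_map g h
  rw [hadj, LinearIsometry.inner_map_map]
  change inner ℝ (UAlpha d (UBeta d k (resolvent d hm ((UBeta d k).symm ((UAlpha d).symm
    (UAlpha d (UBeta d k f.toL2))))))) (UAlpha d (UBeta d k f.toL2)) = _
  rw [LinearIsometryEquiv.symm_apply_apply, LinearIsometryEquiv.symm_apply_apply,
    LinearIsometryEquiv.inner_map_map, LinearIsometryEquiv.inner_map_map]

/-- Cauchy-Schwarz and the resolvent bound; the point is that the right side is free of `k`. -/
lemma inner_covSTilde_stereoTest_le (d : ℕ) {m : ℝ} (hm : 0 < m) (k : ℕ+) (f : RTest d) :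
    inner ℝ (covSTilde d hm k (stereoTest (scaleTest k f)).toL2)
      (stereoTest (scaleTest k f)).toL2 ≤ (m ^ 2)⁻¹ * ‖f.toL2‖ ^ 2 := by
  rw [inner_covSTilde_stereoTest]
  refine (real_inner_le_norm _ _).trans ?_
  rw [sq ‖f.toL2‖, ← mul_assoc]
  exact mul_le_mul_of_nonneg_right (norm_resolvent_apply_le d hm _) (norm_nonneg _)

lemma scaleTest_add {d : ℕ} (k : ℕ+) (f g : RTest d) :
    scaleTest k (f + g) = scaleTest k f + scaleTest k g := by
  ext y
  exact mul_add _ _ _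

lemma scaleTest_smul {d : ℕ} (k : ℕ+) (c : ℝ) (f : RTest d) :
    scaleTest k (c • f) = c • scaleTest k f := by
  ext y
  exact mul_left_comm _ _ _

/-- The function `U_α f` on the punctured sphere. -/
noncomputable def stereoTestFun {d : ℕ} (f : RTest d) (x : PSph d) : ℝ :=
  stereoFactor x ^ ((d : ℝ) / 2) * f (stereo d x)

lemma stereoTest_add {d : ℕ} (f g : RTest d) :
    stereoTest (f + g) = stereoTest f + stereoTest g := by
  have h : stereoTestFun (f + g) = stereoTestFun f + stereoTestFun g :=
    funext fun x => mul_add _ _ _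
  ext x
  exact congrFun ((congrArg extendZero h).trans (extendZero_add _ _)) x

lemma stereoTest_smul {d : ℕ} (c : ℝ) (f : RTest d) :
    stereoTest (c • f) = c • stereoTest f := by
  have h : stereoTestFun (c • f) = c • stereoTestFun f :=
    funext fun x => mul_left_comm _ _ _
  ext x
  exact congrFun ((congrArg extendZero h).trans (extendZero_smul _ _)) x

end ScalingLimit

/-! ### Second moments from Gaussian fourth moments -/

section MomentBounds

open Filter Topology ProbabilityTheory

/-- The `L¹`-`L²` comparison of two measures on bounded continuous functions bounds second moments
by fourth moments. -/
lemma eLpNorm_two_le_of_forall_bounded_continuous {E : Type*} [TopologicalSpace E]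
    [MeasurableSpace E] [BorelSpace E] {γ μ : Measure E} {K : ℝ} (hK : 0 ≤ K)
    (h : ∀ Ψ : BoundedContinuousFunction E ℂ,
      eLpNorm Ψ 1 μ ≤ ENNReal.ofReal K * eLpNorm Ψ 2 γ) {X : E → ℝ} (hX : Continuous X) :
    eLpNorm X 2 μ ≤ ENNReal.ofReal (√K) * eLpNorm X 4 γ := by
  have hsq : ∀ x, ENNReal.ofReal (X x ^ 2) = ‖X x‖ₑ ^ (2 : ℝ) := fun x => by
    rw [← ofReal_norm, ENNReal.ofReal_rpow_of_nonneg (norm_nonneg _) zero_le_two, Real.rpow_two,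
      Real.norm_eq_abs, sq_abs]
  have h4 : eLpNorm (fun x => X x ^ 2) 2 γ = eLpNorm X 4 γ ^ (2 : ℝ) := by
    rw [eLpNorm_eq_lintegral_rpow_enorm_toReal two_ne_zero ENNReal.ofNat_ne_top,
      eLpNorm_eq_lintegral_rpow_enorm_toReal four_ne_zero ENNReal.ofNat_ne_top, ← ENNReal.rpow_mul]
    simp only [ENNReal.toReal_ofNat]
    have h5 : ∀ x, ‖X x ^ 2‖ₑ ^ (2 : ℝ) = ‖X x‖ₑ ^ (4 : ℝ) := fun x => by
      rw [Real.enorm_eq_ofReal (sq_nonneg _), hsq, ← ENNReal.rpow_mul]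
      norm_num
    simp only [h5]
    norm_num
  -- The comparison is available only for bounded functions, so it is applied to `min (X ^ 2) n`;
  -- monotone convergence removes the cutoff.
  have htrunc : ∀ n : ℕ, ∫⁻ x, ENNReal.ofReal (min (X x ^ 2) n) ∂μ ≤
      ENNReal.ofReal K * eLpNorm X 4 γ ^ (2 : ℝ) := by
    intro n
    have hc : Continuous fun x => ((min (X x ^ 2) n : ℝ) : ℂ) := by fun_prop
    have hpos : ∀ x, 0 ≤ min (X x ^ 2) (n : ℝ) := fun x => le_min (sq_nonneg _) n.cast_nonneg
    have hnorm : ∀ x, ‖((min (X x ^ 2) n : ℝ) : ℂ)‖ = min (X x ^ 2) n := fun x => by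
      rw [Complex.norm_real, Real.norm_eq_abs, abs_of_nonneg (hpos x)]
    let Ψ : BoundedContinuousFunction E ℂ := BoundedContinuousFunction.ofNormedAddCommGroup
      (fun x => ((min (X x ^ 2) n : ℝ) : ℂ)) hc n
      (fun x => by rw [hnorm]; exact min_le_right _ _)
    have h1 := h Ψ
    rw [eLpNorm_one_eq_lintegral_enorm] at h1
    refine le_trans (le_of_eq (lintegral_congr fun x => ?_)) (h1.trans ?_)
    · rw [← ofReal_norm]
      exact congrArg _ (hnorm x).symm
    · rw [← h4]
      gcongr
      refine eLpNorm_mono fun x => ?_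
      refine (hnorm x).trans_le ((min_le_left _ _).trans (le_abs_self _))
  have hlim : ∫⁻ x, ENNReal.ofReal (X x ^ 2) ∂μ ≤ ENNReal.ofReal K * eLpNorm X 4 γ ^ (2 : ℝ) := by
    refine le_of_tendsto' (lintegral_tendsto_of_tendsto_of_monotone
      (f := fun (n : ℕ) x => ENNReal.ofReal (min (X x ^ 2) n)) (fun n => ?_) ?_ ?_) htrunc
    · exact (Continuous.measurable (by fun_prop)).ennreal_ofReal.aemeasurable
    · exact Eventually.of_forall fun x n k hnk => ENNReal.ofReal_le_ofReal
        (min_le_min_left _ (by exact_mod_cast hnk))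
    · refine Eventually.of_forall fun x => tendsto_const_nhds.congr' ?_
      obtain ⟨N, hN⟩ := exists_nat_ge (X x ^ 2)
      filter_upwards [eventually_ge_atTop N] with n hn
      rw [min_eq_left (hN.trans (by exact_mod_cast hn))]
  rw [eLpNorm_eq_lintegral_rpow_enorm_toReal two_ne_zero ENNReal.ofNat_ne_top]
  simp only [ENNReal.toReal_ofNat, ← hsq, one_div]
  rw [ENNReal.rpow_inv_le_iff two_pos, ENNReal.mul_rpow_of_nonneg _ _ zero_le_two,
    ENNReal.ofReal_rpow_of_nonneg (Real.sqrt_nonneg _) zero_le_two, Real.rpow_two,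
    Real.sq_sqrt hK]
  exact hlim

/-- A centred normal variable of variance `v` is `√v` times a standard one, so the variance controls
every `L^p` norm. -/
lemma eLpNorm_id_gaussianReal (p : ℝ≥0∞) (v : NNReal) :
    eLpNorm id p (gaussianReal 0 v) = ENNReal.ofReal (√v) * eLpNorm id p (gaussianReal 0 1) := by
  have h := gaussianReal_map_const_mul (μ := 0) (v := 1) (√(v : ℝ))
  have h1 : gaussianReal 0 v = (gaussianReal 0 1).map (√(v : ℝ) * ·) := by
    rw [h]
    congr 1
    · simp
    · ext
      simp
  rw [h1, eLpNorm_map_measure aestronglyMeasurable_id (by fun_prop)]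
  have h2 := eLpNorm_const_smul (√(v : ℝ)) (id : ℝ → ℝ) p (gaussianReal 0 1)
  rw [Real.enorm_eq_ofReal (Real.sqrt_nonneg _)] at h2
  exact h2

end MomentBounds

namespace ScalingLimit

open ProbabilityTheory

lemma STest.toL2_smul {d : ℕ} (c : ℝ) (f : STest d) : (c • f).toL2 = c • f.toL2 := by
  unfold STest.toL2
  rw [← map_smul]
  rfl

/-- The characteristic function of `φ f` at `t` is the characteristic functional at `t • f`, where
the quadratic form gains a factor `t²`. -/
lemma IsGaussianWithCov.map_eval {d : ℕ} {C : Lp ℝ 2 (sphMeas d) →L[ℝ] Lp ℝ 2 (sphMeas d)}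
    {γ : Measure (WeakDual ℝ (STest d))} (h : IsGaussianWithCov C γ) (f : STest d) :
    γ.map (fun φ => φ f) = gaussianReal 0 (inner ℝ (C f.toL2) f.toL2).toNNReal := by
  have := h.radon.isProb
  have hm : Measurable fun φ : WeakDual ℝ (STest d) => φ f := (WeakDual.eval_continuous f).measurable
  -- Positivity of `C` is not assumed: it follows from `|S_γ(f)| ≤ 1`, and makes `toNNReal`
  -- harmless.
  have hq : 0 ≤ inner ℝ (C f.toL2) f.toL2 := by
    have h1 : ‖charFunctional γ f‖ ≤ 1 := by
      unfold charFunctional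
      refine (norm_integral_le_of_norm_le_const (C := 1) (Filter.Eventually.of_forall fun φ => ?_)).trans ?_
      · rw [mul_comm, Complex.norm_exp_ofReal_mul_I]
      · simp
    rw [h.charFunctional_eq, Complex.norm_exp, Real.exp_le_one_iff, Complex.neg_re,
      Complex.ofReal_re] at h1
    linarith
  have := Measure.isProbabilityMeasure_map (μ := γ) hm.aemeasurable
  refine Measure.ext_of_charFun ?_
  funext t
  rw [charFun_gaussianReal, charFun_apply_real, integral_map hm.aemeasurable
    (Continuous.aestronglyMeasurable (by fun_prop))]
  have h1 := h.charFunctional_eq (t • f)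
  rw [STest.toL2_smul, map_smul, inner_smul_left, inner_smul_right] at h1
  unfold charFunctional at h1
  refine Eq.trans (integral_congr_ae (Filter.Eventually.of_forall fun φ => ?_)) (h1.trans ?_)
  · simp only [map_smul, smul_eq_mul]
    push_cast
    congr 1
    ring
  · congr 1
    simp only [Real.coe_toNNReal _ hq]
    push_cast
    simp
    ring

/-- The random fields `φ(U_α U_{β_k} f)` are uniformly bounded in `L²`. -/
theorem exists_eLpNorm_eval_le {d : ℕ} {m : ℝ} (hm : 0 < m)
    {γ μS : ℕ+ → Measure (WeakDual ℝ (STest d))}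
    (hγ : ∀ k, IsGaussianWithCov (covSTilde d hm k) (γ k)) {K : ℝ} (hK : 0 ≤ K)
    (hbound : ∀ (k : ℕ+) (Ψ : BoundedContinuousFunction (WeakDual ℝ (STest d)) ℂ),
      eLpNorm Ψ 1 (μS k) ≤ ENNReal.ofReal K * eLpNorm Ψ 2 (γ k)) :
    ∃ C : ℝ, 0 ≤ C ∧ ∀ (k : ℕ+) (f : RTest d),
      eLpNorm (fun φ : WeakDual ℝ (STest d) => φ (stereoTest (scaleTest k f))) 2 (μS k) ≤
        ENNReal.ofReal (C * ‖f.toL2‖) := by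
  set c := (eLpNorm id 4 (gaussianReal 0 1)).toReal with hc
  have hctop : eLpNorm id 4 (gaussianReal 0 1) ≠ ⊤ := (memLp_id_gaussianReal 4).eLpNorm_ne_top
  -- `√K` comes from the moment comparison, `m⁻¹` from the square root of the variance bound, and
  -- `c` is the `L⁴` norm of a standard normal.
  refine ⟨√K * (m⁻¹ * c), by positivity, fun k f => ?_⟩
  have h1 := eLpNorm_two_le_of_forall_bounded_continuous hK (hbound k)
    (WeakDual.eval_continuous (stereoTest (scaleTest k f)))
  refine h1.trans ?_
  have h2 : eLpNorm (fun φ : WeakDual ℝ (STest d) => φ (stereoTest (scaleTest k f))) 4 (γ k) ≤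
      ENNReal.ofReal (m⁻¹ * ‖f.toL2‖ * c) := by
    have h3 := eLpNorm_map_measure (p := 4) (μ := γ k) (g := (id : ℝ → ℝ))
      (f := fun φ : WeakDual ℝ (STest d) => φ (stereoTest (scaleTest k f)))
      aestronglyMeasurable_id (WeakDual.eval_continuous _).measurable.aemeasurable
    rw [(hγ k).map_eval, eLpNorm_id_gaussianReal, ← ENNReal.ofReal_toReal hctop, ← hc] at h3
    refine le_trans (le_of_eq h3.symm) ?_
    rw [← ENNReal.ofReal_mul (Real.sqrt_nonneg _)]
    refine ENNReal.ofReal_le_ofReal (mul_le_mul_of_nonneg_right ?_ ENNReal.toReal_nonneg)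
    refine Real.sqrt_le_iff.2 ⟨by positivity, ?_⟩
    rw [Real.coe_toNNReal']
    refine max_le ?_ (by positivity)
    refine (inner_covSTilde_stereoTest_le d hm k f).trans (le_of_eq ?_)
    rw [mul_pow, inv_pow]
  refine (mul_le_mul_right h2 _).trans (le_of_eq ?_)
  rw [← ENNReal.ofReal_mul (Real.sqrt_nonneg _)]
  congr 1
  ring

end ScalingLimit

/-! ### Hilbert-Schmidt operators from kernels -/

section KernelOperator

open Filter

/-- A square integrable family of vectors is the kernel of a Hilbert-Schmidt operator into `L²`. -/
theorem exists_hilbertSchmidt_of_kernel {E H ι : Type*} [MeasurableSpace E] {μ : Measure E}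
    [NormedAddCommGroup H] [InnerProductSpace ℝ H] [Countable ι] (b : HilbertBasis ι ℝ H)
    (k : E → H) (hk : ∀ g, AEStronglyMeasurable (fun y => inner ℝ (k y) g) μ)
    (hn : MemLp (fun y => ‖k y‖) 2 μ) :
    ∃ A : H →L[ℝ] Lp ℝ 2 μ, (∀ g, A g =ᵐ[μ] fun y => inner ℝ (k y) g) ∧
      Summable fun i => ‖A (b i)‖ ^ 2 := by
  have hmem : ∀ g, MemLp (fun y => inner ℝ (k y) g) 2 μ := fun g =>
    hn.of_le_mul (hk g) (Eventually.of_forall fun y => by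
      rw [norm_norm, mul_comm]
      exact norm_inner_le_norm (k y) g)
  let A₀ : H →ₗ[ℝ] Lp ℝ 2 μ :=
    { toFun := fun g => (hmem g).toLp _
      map_add' := fun g h => by
        rw [← MemLp.toLp_add, MemLp.toLp_eq_toLp_iff]
        exact Eventually.of_forall fun y => inner_add_right _ _ _
      map_smul' := fun c g => by
        rw [RingHom.id_apply, ← MemLp.toLp_const_smul, MemLp.toLp_eq_toLp_iff]
        exact Eventually.of_forall fun y => inner_smul_right _ _ _ }
  let A : H →L[ℝ] Lp ℝ 2 μ := A₀.mkContinuous ‖hn.toLp _‖ fun g => by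
    rw [mul_comm]
    refine Lp.norm_le_mul_norm_of_ae_le_mul ?_
    filter_upwards [(hmem g).coeFn_toLp, hn.coeFn_toLp] with y h1 h2
    change ‖(hmem g).toLp _ y‖ ≤ _
    rw [h1, h2, norm_norm, mul_comm]
    exact norm_inner_le_norm (k y) g
  have hA : ∀ g, A g =ᵐ[μ] fun y => inner ℝ (k y) g := fun g => (hmem g).coeFn_toLp
  refine ⟨A, hA, ?_⟩
  have hnorm : ∀ i, ∫⁻ y, ENNReal.ofReal (inner ℝ (k y) (b i) ^ 2) ∂μ =
      ENNReal.ofReal (‖A (b i)‖ ^ 2) := by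
    intro i
    have h3 : ‖A (b i)‖ ^ 2 = ∫ y, inner ℝ (k y) (b i) ^ 2 ∂μ := by
      rw [← real_inner_self_eq_norm_sq, L2.inner_def]
      refine integral_congr_ae ((hA (b i)).mono fun y hy => ?_)
      simp only [hy, real_inner_self_eq_norm_sq, Real.norm_eq_abs, sq_abs]
    rw [h3, ofReal_integral_eq_lintegral_ofReal (hmem (b i)).integrable_sq
      (Eventually.of_forall fun y => sq_nonneg _)]
  -- By Tonelli and Parseval the sum equals `∫ ‖k y‖² dμ`.
  have htsum : ∑' i, ENNReal.ofReal (‖A (b i)‖ ^ 2) ≠ ⊤ := by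
    simp_rw [← hnorm]
    rw [← lintegral_tsum fun i => ((hk (b i)).aemeasurable.pow_const 2).ennreal_ofReal]
    have h4 : ∀ y, ∑' i, ENNReal.ofReal (inner ℝ (k y) (b i) ^ 2) = ENNReal.ofReal (‖k y‖ ^ 2) := by
      intro y
      have h5 := b.hasSum_inner_mul_inner (k y) (k y)
      rw [real_inner_self_eq_norm_sq] at h5
      have h6 : ∀ i, inner ℝ (k y) (b i) * inner ℝ (b i) (k y) = inner ℝ (k y) (b i) ^ 2 :=
        fun i => by rw [real_inner_comm (k y) (b i), sq]
      simp only [h6] at h5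
      rw [← ENNReal.ofReal_tsum_of_nonneg (fun i => sq_nonneg _) h5.summable, h5.tsum_eq]
    simp_rw [h4]
    exact (hn.integrable_sq.lintegral_lt_top).ne
  have := ENNReal.summable_toReal htsum
  simpa [ENNReal.toReal_ofReal, sq_nonneg] using this

end KernelOperator

/-! ### Test functions inside Schwartz space and `L²` -/

namespace ScalingLimit

open scoped SchwartzMap FourierTransform Distributions

/-- Test functions form a continuously embedded subspace of the Schwartz space. -/
noncomputable def RTest.toSchwartz (d : ℕ) : RTest d →L[ℝ] 𝓢(Eu d, ℝ) :=
  TestFunction.mkCLM ℝ (fun f => f.hasCompactSupport.toSchwartzMap f.contDiff)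
    (fun _ _ => rfl) (fun _ _ => rfl) fun K hK => by
      let T : ContDiffMapSupportedIn (Eu d) ℝ ⊤ K →ₗ[ℝ] 𝓢(Eu d, ℝ) :=
        { toFun := fun f => f.hasCompactSupport.toSchwartzMap f.contDiff
          map_add' := fun _ _ => rfl
          map_smul' := fun _ _ => rfl }
      change Continuous T
      obtain ⟨R, hR⟩ := K.isCompact.isBounded.exists_norm_le
      refine WithSeminorms.continuous_of_isBounded
        (ContDiffMapSupportedIn.withSeminorms ℝ (Eu d) ℝ ⊤ K)
        (schwartz_withSeminorms ℝ (Eu d) ℝ) T (Seminorm.IsBounded.of_real ?_)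
      rintro ⟨k, n⟩
      -- On `K` the factor `‖x‖ ^ k` is at most `|R| ^ k`, and off `K` the derivative vanishes; `R`
      -- itself need not be nonnegative if `K` is empty.
      refine ⟨{n}, |R| ^ k, fun f => ?_⟩
      simp only [Finset.sup_singleton]
      refine SchwartzMap.seminorm_le_bound ℝ k n (T f) (by positivity) fun x => ?_
      change ‖x‖ ^ k * ‖iteratedFDeriv ℝ n f x‖ ≤ |R| ^ k * _
      by_cases hx : x ∈ K
      · gcongr
        · exact (hR x hx).trans (le_abs_self R)
        · exact ContDiffMapSupportedIn.norm_iteratedFDeriv_apply_le_seminorm_top ℝ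
      · rw [f.iteratedFDeriv_zero_on_compl hx]
        simp only [Pi.zero_apply, norm_zero, mul_zero]
        positivity

/-- The inclusion factors through Schwartz space. This converts Lipschitz bounds in the `L²` norm
into equicontinuity for the LF topology. -/
lemma RTest.continuous_toL2 {d : ℕ} : Continuous (RTest.toL2 (d := d)) :=
  (SchwartzMap.toLpCLM ℝ ℝ 2 volume ∘L RTest.toSchwartz d).continuous

/-- Test functions are dense in `L²(ℝ^d)`. -/
lemma RTest.denseRange_toL2 (d : ℕ) : DenseRange (RTest.toL2 (d := d)) := by
  intro f
  refine (mem_closure_iff_nhds_basis Metric.nhds_basis_closedBall).2 fun ε hε => ?_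
  obtain ⟨g, hg₁, hg₂, hg₃⟩ := MemLp.exist_eLpNorm_sub_le ENNReal.ofNat_ne_top
    (one_le_two (α := ℝ≥0∞)) (Lp.memLp f) hε
  let G : RTest d := ⟨g, hg₂, hg₁, Set.subset_univ _⟩
  refine ⟨G.toL2, ⟨G, rfl⟩, ?_⟩
  have h1 : (f : Eu d → ℝ) - (G.toL2 : Eu d → ℝ) =ᵐ[volume] (f : Eu d → ℝ) - g := by
    filter_upwards [G.memLp.coeFn_toLp] with x hx
    change f x - G.memLp.toLp G x = _
    rw [hx]
    rfl
  rw [Metric.mem_closedBall', Lp.dist_def, eLpNorm_congr_ae h1]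
  exact ENNReal.toReal_le_of_le_ofReal hε.le hg₃

end ScalingLimit

/-! ### Point evaluation through a weighted Fourier kernel -/

namespace ScalingLimit

open scoped SchwartzMap FourierTransform

/-- The polynomial weight `(1 + |x|²)^(d+1)`. -/
noncomputable def weight {d : ℕ} (x : Eu d) : ℝ := (1 + ‖x‖ ^ 2) ^ (d + 1)

lemma weight_pos {d : ℕ} (x : Eu d) : 0 < weight x := by unfold weight; positivity

lemma hasTemperateGrowth_weight (d : ℕ) : Function.HasTemperateGrowth (weight (d := d)) := by
  unfold weight
  fun_prop

lemma continuous_weight (d : ℕ) : Continuous (weight (d := d)) := by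
  unfold weight
  fun_prop

lemma memLp_inv_weight (d : ℕ) : MemLp (fun x : Eu d => (weight x)⁻¹) 2 volume := by
  have hc : Continuous fun x : Eu d => (weight x)⁻¹ :=
    (continuous_weight d).inv₀ fun x => (weight_pos x).ne'
  rw [memLp_two_iff_integrable_sq hc.aestronglyMeasurable]
  -- The squared inverse weight is `(1 + |x|²)^(-r/2)` with `r = 4(d + 1)`, which exceeds the
  -- dimension `d`.
  have h := integrable_rpow_neg_one_add_norm_sq (E := Eu d) (μ := volume)
    (r := 4 * ((d : ℝ) + 1)) (by rw [finrank_euclideanSpace_fin]; linarith [d.cast_nonneg (α := ℝ)])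
  refine h.congr (Filter.Eventually.of_forall fun x => ?_)
  simp only [weight]
  have h1 : (0 : ℝ) ≤ 1 + ‖x‖ ^ 2 := by positivity
  rw [← inv_pow, ← pow_mul, inv_pow, ← Real.rpow_natCast (1 + ‖x‖ ^ 2) ((d + 1) * 2),
    ← Real.rpow_neg h1]
  congr 1
  push_cast
  ring

/-- The function `ξ ↦ e^(-2πi⟨ξ,y⟩) / ((1 + |y|²)^(d+1) (1 + |ξ|²)^(d+1))`. -/
noncomputable def fourierKernelFun {d : ℕ} (y ξ : Eu d) : ℂ :=
  ((weight y)⁻¹ * (weight ξ)⁻¹ : ℝ) * Complex.exp (-((2 * Real.pi * inner ℝ ξ y : ℝ) * Complex.I))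

lemma continuous_fourierKernelFun (d : ℕ) :
    Continuous fun p : Eu d × Eu d => fourierKernelFun p.1 p.2 := by
  have hc : Continuous fun x : Eu d => (weight x)⁻¹ :=
    (continuous_weight d).inv₀ fun x => (weight_pos x).ne'
  unfold fourierKernelFun
  have h1 := hc.comp (continuous_fst (X := Eu d) (Y := Eu d))
  have h2 := hc.comp (continuous_snd (X := Eu d) (Y := Eu d))
  simp only [Function.comp_def] at h1 h2
  fun_prop

lemma norm_fourierKernelFun {d : ℕ} (y ξ : Eu d) :
    ‖fourierKernelFun y ξ‖ = (weight y)⁻¹ * (weight ξ)⁻¹ := by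
  have h := weight_pos y
  have h' := weight_pos ξ
  rw [fourierKernelFun, norm_mul, ← neg_mul, ← Complex.ofReal_neg, Complex.norm_exp_ofReal_mul_I,
    mul_one, Complex.norm_real, Real.norm_of_nonneg (by positivity)]

lemma memLp_fourierKernelFun {d : ℕ} (y : Eu d) : MemLp (fourierKernelFun y) 2 volume := by
  refine (memLp_inv_weight d).of_le_mul (c := (weight y)⁻¹)
    ((continuous_fourierKernelFun d).comp (by fun_prop : Continuous fun ξ : Eu d => (y, ξ))).aestronglyMeasurable
    (Filter.Eventually.of_forall fun ξ => ?_)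
  rw [norm_fourierKernelFun, Real.norm_of_nonneg (inv_nonneg.2 (weight_pos ξ).le)]

/-- The vectors of `L²` that represent the point evaluations of test functions. -/
noncomputable def fourierKernel {d : ℕ} (y : Eu d) : Lp ℂ 2 (volume : Measure (Eu d)) :=
  (memLp_fourierKernelFun y).toLp _

lemma norm_fourierKernel {d : ℕ} (y : Eu d) :
    ‖fourierKernel y‖ = (weight y)⁻¹ * ‖(memLp_inv_weight d).toLp _‖ := by
  have h : eLpNorm (fourierKernelFun y) 2 volume =
      ‖(weight y)⁻¹‖ₑ * eLpNorm (fun x : Eu d => (weight x)⁻¹) 2 volume := by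
    rw [← eLpNorm_const_smul]
    refine eLpNorm_congr_norm_ae (Filter.Eventually.of_forall fun ξ => ?_)
    have h1 := weight_pos y
    have h2 := weight_pos ξ
    rw [norm_fourierKernelFun, Pi.smul_apply, smul_eq_mul, Real.norm_of_nonneg (by positivity)]
  rw [fourierKernel, Lp.norm_toLp, Lp.norm_toLp, h, ENNReal.toReal_mul, toReal_enorm,
    Real.norm_of_nonneg (inv_nonneg.2 (weight_pos y).le)]

/-- The Hilbert-Schmidt condition on the kernel: the weight in `ξ` makes each vector square
integrable, the weight in `y` the family of norms. -/
lemma memLp_norm_fourierKernel (d : ℕ) :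
    MemLp (fun y : Eu d => ‖fourierKernel y‖) 2 volume := by
  simp_rw [norm_fourierKernel]
  exact (memLp_inv_weight d).mul_const _

/-- Each `fourierKernel y` is only an `L²` class, so measurability in `y` is read off from an
integral with jointly measurable integrand. -/
lemma aestronglyMeasurable_inner_fourierKernel {d : ℕ} (g : Lp ℂ 2 (volume : Measure (Eu d))) :
    AEStronglyMeasurable (fun y : Eu d => inner ℝ (fourierKernel y) g) volume := by
  have h : ∀ y : Eu d, inner ℝ (fourierKernel y) g = ∫ ξ, inner ℝ (fourierKernelFun y ξ) (g ξ) := by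
    intro y
    rw [L2.inner_def]
    refine integral_congr_ae ((memLp_fourierKernelFun y).coeFn_toLp.mono fun ξ hξ => ?_)
    simp only [fourierKernel, hξ]
  simp_rw [h]
  refine StronglyMeasurable.aestronglyMeasurable ?_
  refine StronglyMeasurable.integral_prod_right
    (f := fun y ξ : Eu d => inner ℝ (fourierKernelFun y ξ) (g ξ)) ?_
  exact (continuous_fourierKernelFun d).stronglyMeasurable.inner
    ((Lp.stronglyMeasurable g).comp_measurable measurable_snd)

/-- The Schwartz function `(1 + |ξ|²)^(d+1) 𝓕((1 + |·|²)^(d+1) f)(ξ)`. -/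
noncomputable def weightedFourier (d : ℕ) : RTest d →L[ℝ] 𝓢(Eu d, ℂ) :=
  SchwartzMap.smulLeftCLM ℂ (weight (d := d)) ∘L SchwartzMap.fourierTransformCLM ℝ ∘L
    SchwartzMap.smulLeftCLM ℂ (weight (d := d)) ∘L
    SchwartzMap.postcompCLM Complex.ofRealCLM ∘L RTest.toSchwartz d

/-- `weightedFourier` as a map to `L²`. -/
noncomputable def weightedFourierL2 (d : ℕ) : RTest d →L[ℝ] Lp ℂ 2 (volume : Measure (Eu d)) :=
  SchwartzMap.toLpCLM ℝ ℂ 2 volume ∘L weightedFourier d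

/-- Fourier inversion for `F = weight · f`: the kernel's `ξ`-weight cancels the one applied after
the transform, its `y`-weight the one applied before. -/
lemma inner_fourierKernel_weightedFourierL2 {d : ℕ} (f : RTest d) (y : Eu d) :
    inner ℝ (fourierKernel y) (weightedFourierL2 d f) = f y := by
  set F : 𝓢(Eu d, ℂ) := SchwartzMap.smulLeftCLM ℂ (weight (d := d))
    (SchwartzMap.postcompCLM Complex.ofRealCLM (RTest.toSchwartz d f)) with hF
  have hw : ∀ ξ, weightedFourier d f ξ = (weight ξ : ℂ) * 𝓕 F ξ := fun ξ => by
    change SchwartzMap.smulLeftCLM ℂ (weight (d := d)) (𝓕 F) ξ = _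
    rw [SchwartzMap.smulLeftCLM_apply_apply (hasTemperateGrowth_weight d), Complex.real_smul]
  have hFy : F y = (weight y : ℂ) * f y := by
    rw [hF, SchwartzMap.smulLeftCLM_apply_apply (hasTemperateGrowth_weight d), Complex.real_smul]
    rfl
  have hint : ∫ ξ, Complex.exp ((2 * Real.pi * inner ℝ ξ y : ℝ) * Complex.I) * 𝓕 F ξ = F y := by
    have h1 : 𝓕⁻ (𝓕 F) y = F y := by rw [FourierTransform.fourierInv_fourier_eq]
    rw [← h1, SchwartzMap.fourierInv_coe, Real.fourierInv_eq']
    rfl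
  have hI : Integrable fun ξ => Complex.exp ((2 * Real.pi * inner ℝ ξ y : ℝ) * Complex.I) * 𝓕 F ξ := by
    refine (𝓕 F).integrable.mono (Continuous.aestronglyMeasurable ?_)
      (Filter.Eventually.of_forall fun ξ => ?_)
    · have := (𝓕 F).continuous
      fun_prop
    · rw [norm_mul, Complex.norm_exp_ofReal_mul_I, one_mul]
  have hcongr : inner ℝ (fourierKernel y) (weightedFourierL2 d f) =
      ∫ ξ, (weight y)⁻¹ * (Complex.exp ((2 * Real.pi * inner ℝ ξ y : ℝ) * Complex.I) * 𝓕 F ξ).re := by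
    rw [L2.inner_def]
    refine integral_congr_ae ?_
    filter_upwards [(memLp_fourierKernelFun y).coeFn_toLp,
      (weightedFourier d f).coeFn_toLp 2 volume] with ξ h1 h2
    have h3 : (weightedFourierL2 d f : Eu d → ℂ) ξ = weightedFourier d f ξ := h2
    simp only [fourierKernel, h1, h3, hw, fourierKernelFun]
    -- The inner product conjugates the kernel, turning `e^(-2πi⟨ξ,y⟩)` into the kernel of the
    -- inverse transform.
    rw [Complex.inner, map_mul, Complex.conj_ofReal, ← Complex.exp_conj, map_neg, map_mul,
      Complex.conj_ofReal, Complex.conj_I, mul_neg, neg_neg]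
    have h4 : (weight ξ : ℂ) * 𝓕 F ξ * ((((weight y)⁻¹ * (weight ξ)⁻¹ : ℝ) : ℂ) *
        Complex.exp ((2 * Real.pi * inner ℝ ξ y : ℝ) * Complex.I)) =
        ((weight y)⁻¹ : ℝ) *
          (Complex.exp ((2 * Real.pi * inner ℝ ξ y : ℝ) * Complex.I) * 𝓕 F ξ) := by
      have h5 : (weight ξ : ℂ) ≠ 0 := by exact_mod_cast (weight_pos ξ).ne'
      push_cast
      field_simp
    rw [h4, Complex.re_ofReal_mul]
  -- The real inner product sees only real parts; nothing is lost, as `F y` is real.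
  have hre : ∫ ξ, (Complex.exp ((2 * Real.pi * inner ℝ ξ y : ℝ) * Complex.I) * 𝓕 F ξ).re =
      (F y).re := by
    rw [← hint]
    exact integral_re hI
  rw [hcongr, integral_const_mul, hre, hFy, Complex.re_ofReal_mul, Complex.ofReal_re,
    inv_mul_cancel_left₀ (weight_pos y).ne']

end ScalingLimit

/-! ### Countability of orthonormal families -/

section HilbertBasis

/-- An orthonormal family in a separable space is countable. -/
lemma Orthonormal.countable_of_separable {H ι : Type*} [NormedAddCommGroup H]
    [InnerProductSpace ℝ H] [TopologicalSpace.SeparableSpace H] {v : ι → H}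
    (hv : Orthonormal ℝ v) : Countable ι := by
  refine Pairwise.countable_of_isOpen_disjoint (s := fun i => Metric.ball (v i) (1 / 2))
    (fun i j hij => Metric.ball_disjoint_ball ?_) (fun i => Metric.isOpen_ball)
    fun i => ⟨v i, Metric.mem_ball_self (by norm_num)⟩
  -- Distinct members are at distance `√2 > 1`, so the balls of radius `1 / 2` are disjoint.
  have h := norm_sub_sq_real (v i) (v j)
  rw [hv.2 hij, hv.1, hv.1] at h
  rw [dist_eq_norm]
  nlinarith [norm_nonneg (v i - v j)]

end HilbertBasis

/-! ### Realisation by a Radon measure on distributions -/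

namespace ScalingLimit

open Filter Topology

instance secondCountable_L2 {d : ℕ} {F : Type*} [NormedAddCommGroup F]
    [TopologicalSpace.SeparableSpace F] :
    SecondCountableTopology (Lp F 2 (volume : Measure (Eu d))) :=
  have : Fact ((2 : ℝ≥0∞) ≠ ⊤) := ⟨ENNReal.ofNat_ne_top⟩
  inferInstance

/-- A random linear functional that is continuous for the norm of `L²(ℝ^d)` is the evaluation of a
random distribution. -/
theorem exists_radon_of_random_functional {d : ℕ} {Ω : Type*} [MeasurableSpace Ω] {ν : Measure Ω}
    [IsProbabilityMeasure ν]
    (Y : Lp ℝ 2 (volume : Measure (Eu d)) →L[ℝ] Lp ℝ 2 ν) :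
    ∃ μ : Measure (WeakDual ℝ (RTest d)), IsRadonProb μ ∧
      ∀ f, charFunctional μ f = ∫ w, Complex.exp (Complex.I * (Y f.toL2 w : ℂ)) ∂ν := by
  let H := Lp ℂ 2 (volume : Measure (Eu d))
  let _ : MeasurableSpace H := borel H
  have _ : BorelSpace H := ⟨rfl⟩
  obtain ⟨s, b, -⟩ := exists_hilbertBasis ℝ H
  have _ : Countable s := b.orthonormal.countable_of_separable
  obtain ⟨A, hA, hAs⟩ := exists_hilbertSchmidt_of_kernel b fourierKernel
    aestronglyMeasurable_inner_fourierKernel (memLp_norm_fourierKernel d)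
  obtain ⟨Z, hZm, hZ⟩ := exists_random_vector Y A b hAs
  -- The factorisation of the inclusion into `L²`; it gives `Y f = ⟨Z, weightedFourierL2 d f⟩`
  -- almost everywhere.
  have hrep : ∀ f : RTest d, A (weightedFourierL2 d f) = f.toL2 := by
    intro f
    ext1
    refine (hA _).trans ?_
    filter_upwards [f.memLp.coeFn_toLp] with y hy
    exact (inner_fourierKernel_weightedFourierL2 f y).trans hy.symm
  let J : H → WeakDual ℝ (RTest d) := fun h =>
    StrongDual.toWeakDual ((innerSL ℝ h) ∘L weightedFourierL2 d)
  have hJ : ∀ h f, J h f = inner ℝ h (weightedFourierL2 d f) := fun h f => rfl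
  have hJc : Continuous J := by
    refine WeakDual.continuous_of_continuous_eval fun f => ?_
    simp_rw [hJ]
    fun_prop
  have hprob : IsProbabilityMeasure (ν.map Z) := Measure.isProbabilityMeasure_map hZm
  -- The law of `Z` is inner regular, being a finite Borel measure on a separable Hilbert space, and
  -- continuous images inherit this.
  refine ⟨(ν.map Z).map J, ⟨Measure.isProbabilityMeasure_map hJc.measurable.aemeasurable,
    Measure.InnerRegular.map_of_continuous hJc⟩, fun f => ?_⟩
  unfold charFunctional
  have hc1 : Continuous fun φ : WeakDual ℝ (RTest d) => Complex.exp (Complex.I * (φ f : ℂ)) :=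
    Complex.continuous_exp.comp (continuous_const.mul
      (Complex.continuous_ofReal.comp (WeakDual.eval_continuous f)))
  have hc2 : Continuous fun h : H => Complex.exp (Complex.I * (J h f : ℂ)) := hc1.comp hJc
  rw [integral_map hJc.measurable.aemeasurable hc1.aestronglyMeasurable,
    integral_map hZm hc2.aestronglyMeasurable]
  refine integral_congr_ae ((hZ (weightedFourierL2 d f)).mono fun w hw => ?_)
  simp only at hw
  simp only [hJ, hw, hrep]

end ScalingLimit

/-- An equicontinuous family that converges pointwise converges uniformly on compact sets. -/
lemma Equicontinuous.tendstoUniformlyOn_of_isCompact {X α ι : Type*} [TopologicalSpace X]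
    [UniformSpace α] {F : ι → X → α} (hF : Equicontinuous F) {l : Filter ι} {f : X → α}
    (h : ∀ x, Filter.Tendsto (fun i => F i x) l (nhds (f x))) {A : Set X} (hA : IsCompact A) :
    TendstoUniformlyOn F f l A := by
  have h1 := (EquicontinuousOn.tendsto_uniformOnFun_iff_pi' (𝔖 := {A}) (by simpa using hA)
    (fun K _ => hF.equicontinuousOn K) l f).2
    (tendsto_pi_nhds.2 fun x => h x)
  exact UniformOnFun.tendsto_iff_tendstoUniformlyOn.1 h1 A rfl

/-! ### Equicontinuity and the convergent subsequence -/

open ScalingLimit Filter Topology in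
theorem mainTheorem6 (d : ℕ) (hd : 1 ≤ d) (m : ℝ) (hm : 0 < m)
    (γ μS : ℕ+ → Measure (WeakDual ℝ (STest d)))
    (hγ : ∀ k, IsGaussianWithCov (covSTilde d hm k) (γ k))
    (hμS : ∀ k, IsRadonProb (μS k))
    (K : ℝ) (hK : 0 < K)
    (hbound : ∀ (k : ℕ+) (Ψ : BoundedContinuousFunction (WeakDual ℝ (STest d)) ℂ),
      eLpNorm Ψ 1 (μS k) ≤ ENNReal.ofReal K * eLpNorm Ψ 2 (γ k)) :
    Equicontinuous (fun (k : ℕ+) (f : RTest d) =>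
      charFunctional (μS k) (stereoTest (scaleTest k f))) ∧
    ∃ (φ : ℕ → ℕ+) (μE : Measure (WeakDual ℝ (RTest d))), StrictMono φ ∧ IsRadonProb μE ∧
      Continuous (charFunctional μE) ∧
      ∀ A : Set (RTest d), IsCompact A → TendstoUniformlyOn
        (fun (n : ℕ) (f : RTest d) => charFunctional (μS (φ n)) (stereoTest (scaleTest (φ n) f)))
        (charFunctional μE) Filter.atTop A := by
  obtain ⟨C, hC0, hC⟩ := exists_eLpNorm_eval_le hm hγ hK.le hbound
  have hprob : ∀ k, IsProbabilityMeasure (μS k) := fun k => (hμS k).isProb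
  let X : ∀ k : ℕ+, RTest d → WeakDual ℝ (STest d) → ℝ :=
    fun k f φ => φ (stereoTest (scaleTest k f))
  have hX : ∀ k f, Measurable (X k f) := fun k f =>
    (WeakDual.eval_continuous (stereoTest (scaleTest k f))).measurable
  have hadd : ∀ k f g, X k (f + g) = X k f + X k g := fun k f g => by
    funext φ
    simp only [X, scaleTest_add, stereoTest_add, map_add, Pi.add_apply]
  have hsmul : ∀ k (c : ℝ) f, X k (c • f) = c • X k f := fun k c f => by
    funext φ
    simp only [X, scaleTest_smul, stereoTest_smul, map_smul, Pi.smul_apply]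
  have hlip : ∀ k f g, dist (charFunctional (μS k) (stereoTest (scaleTest k f)))
      (charFunctional (μS k) (stereoTest (scaleTest k g))) ≤ C * dist f.toL2 g.toL2 := by
    intro k f g
    rw [dist_eq_norm, dist_eq_norm]
    refine norm_integral_exp_I_mul_sub_le (hX k f).aemeasurable (hX k g).aemeasurable
      (by positivity) ?_
    have hsub : X k f - X k g = X k (f - g) := by
      rw [sub_eq_add_neg f, hadd, ← neg_one_smul ℝ g, hsmul, neg_one_smul, sub_eq_add_neg]
    rw [← map_sub]
    exact (congrArg (fun U => eLpNorm U 2 (μS k)) hsub).trans_le (hC k (f - g))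
  have hequi : Equicontinuous (fun (k : ℕ+) (f : RTest d) =>
      charFunctional (μS k) (stereoTest (scaleTest k f))) := by
    intro f
    have h : Continuous fun g : RTest d => C * dist f.toL2 g.toL2 :=
      continuous_const.mul (continuous_const.dist RTest.continuous_toL2)
    have h0 := h.tendsto f
    rw [dist_self, mul_zero] at h0
    -- The modulus `C ‖f - g‖` in `L²` is independent of `k` and continuous on `𝓓(ℝ^d)`.
    refine Metric.equicontinuousAt_of_continuity_modulus
      (fun g : RTest d => C * dist f.toL2 g.toL2) h0
      (fun (k : ℕ+) (f : RTest d) => charFunctional (μS k) (stereoTest (scaleTest k f))) ?_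
    exact Eventually.of_forall fun g k => hlip k f g
  -- Extraction works with indices in `ℕ`; `succPNat` shifts them to `k = n + 1`.
  obtain ⟨φ, ν, hν, Y, hφ, hY, hlim⟩ := exists_subseq_tendsto_law (RTest.denseRange_toL2 d)
    (Ω := fun _ => WeakDual ℝ (STest d)) (P := fun n => μS n.succPNat)
    (X := fun n => X n.succPNat) (fun n f => hX _ f) (fun n f g => hadd _ f g)
    (fun n c f => hsmul _ c f) hC0 (fun n f => hC _ f)
  obtain ⟨μE, hμE, hchar⟩ := exists_radon_of_random_functional Y
  have hpt : ∀ f, Tendsto (fun n => charFunctional (μS (φ n).succPNat)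
      (stereoTest (scaleTest (φ n).succPNat f))) atTop (𝓝 (charFunctional μE f)) := by
    intro f
    rw [hchar]
    exact hlim f
  have hequi' := hequi.comp fun n => (φ n).succPNat
  have hcont : Continuous (charFunctional μE) :=
    Filter.Tendsto.continuous_of_equicontinuous (tendsto_pi_nhds.2 hpt) hequi'
  refine ⟨hequi, fun n => (φ n).succPNat, μE, fun a b hab => Nat.succPNat_lt_succPNat.2 (hφ hab),
    hμE, hcont, fun A hA => hequi'.tendstoUniformlyOn_of_isCompact hpt hA⟩
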